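/- Let $(X,\nu)$ be a standard Borel space with a non-atomic probability measure $\nu$, and let $\Lambda$ be a measure on $[0,\infty)$ with $\Lambda(0,\infty)=\infty$, $\Lambda(1,\infty)<\infty$, $\int_0^1 s\,d\Lambda(s)<\infty$ and $\Lambda(\{0\})=0$. Put $\psi_\Lambda(t)=\exp\left(-\int_0^\infty(1-e^{-ts})\,d\Lambda(s)\right)$ for $t\ge 0$. Let $D$ be the space of finite real discrete measures $\sum z_i\delta_{x_i}$ on $X$ ($\sum|z_i|<\infty$), with the $\sigma$-algebra generated by the maps $\eta\mapsto\eta(A)$, $A\subset X$ measurable. Let $P_\Lambda$ be the law of a homogeneous Lévy process on $(X,\nu)$ with Lévy measure $\Lambda$, i.e. a probability measure on $D$ such that $$\mathbb E\left[\exp\left(-\int_X a(x)\,d\eta(x)\right)\right]=\exp\left(\int_X\log\psi_\Lambda(a(x))\,d\nu(x)\right)$$ for every non-negative bounded Borel function $a$ on $X$. Let $C$ be the cone of sequences $z_1\ge z_2\ge\dots\ge 0$ with $\sum z_i<\infty$. Then almost every $\eta$ is a positive measure with infinitely many atoms, $\eta=\sum_i Q_i\delta_{X_i}$ with $Q_1\ge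 Q_2\ge\dots>0$ and distinct $X_i\in X$. The sequence of charges $(Q_i)\in C$ is determined by $\eta$; its law $\varkappa_\Lambda$ is called the conic part of $P_\Lambda$. The sequence $(X_i)$ is determined by $\eta$ up to the order of atoms of equal charge; let these (finitely many for each charge) be listed in uniformly random order, and let $TP_\Lambda$ be the resulting law of $\big((Q_i),(X_i)\big)$ on $C\times X^\infty$. Then this law exists and $$TP_\Lambda=\varkappa_\Lambda\times\nu^\infty,$$ i.e. $X_1,X_2,\dots$ is a sequence of i.i.d. random variables with common distribution $\nu$, and this sequence is independent of the conic part $(Q_i)$. -/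

import Mathlib

open MeasureTheory ProbabilityTheory
open scoped NNReal ENNReal

noncomputable section

namespace LevyDecomposition

/-- `m` is a finite real discrete measure: `m = ∑ zᵢ δ_{xᵢ}` with `∑ |zᵢ| < ∞`.
Zero charges and repeated points are allowed here, so finite sums are covered. -/
def IsDiscrete {X : Type*} [MeasurableSpace X] (m : SignedMeasure X) : Prop :=
  ∃ (z : ℕ → ℝ) (x : ℕ → X), Summable (fun i => |z i|) ∧
    ∀ A : Set X, MeasurableSet A → m A = ∑' i, z i * A.indicator 1 (x i)

/-- The space `D` of all finite real discrete measures on `X`. -/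
structure D (X : Type*) [MeasurableSpace X] where
  toSignedMeasure : SignedMeasure X
  isDiscrete : IsDiscrete toSignedMeasure

/-- The σ-algebra on `D` generated by the evaluations `η ↦ η(A)`, `A ⊆ X` measurable. -/
instance instMeasurableSpaceD (X : Type*) [MeasurableSpace X] : MeasurableSpace (D X) :=
  ⨆ (A : Set X) (_ : MeasurableSet A), (borel ℝ).comap (fun η : D X => η.toSignedMeasure A)

/-- The integral `∫ a dη` of a real function against `η ∈ D`. -/
def D.integral {X : Type*} [MeasurableSpace X] (η : D X) (a : X → ℝ) : ℝ :=
  VectorMeasure.integral η.toSignedMeasure a (ContinuousLinearMap.lsmul ℝ ℝ)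

/-- The conditions imposed on a Lévy measure `Λ` on the half-line `ℝ₊ = [0, ∞)`. -/
structure IsLevyMeasure (Λ : Measure ℝ≥0) : Prop where
  infinite : Λ (Set.Ioi 0) = ∞
  tail_finite : Λ (Set.Ioi 1) < ∞
  small_jumps : ∫⁻ s in Set.Ioc 0 1, (s : ℝ≥0∞) ∂Λ < ∞
  no_atom_zero : Λ {0} = 0

/-- The Laplace transform `ψ_Λ(t) = exp(-∫ (1 - e^{-ts}) dΛ(s))` of the infinitely divisible
law with Lévy measure `Λ`. -/
def psi (Λ : Measure ℝ≥0) (t : ℝ) : ℝ :=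
  Real.exp (-∫ s : ℝ≥0, (1 - Real.exp (-(t * s))) ∂Λ)

/-- `P` is the law on `D` of a homogeneous Lévy process on `(X, ν)` with Lévy measure `Λ`. -/
structure IsHomogeneousLevyLaw {X : Type*} [MeasurableSpace X] (ν : Measure X) (Λ : Measure ℝ≥0)
    (P : Measure (D X)) : Prop where
  isProbabilityMeasure : IsProbabilityMeasure P
  laplace : ∀ a : X → ℝ, Measurable a → (∀ x, 0 ≤ a x) → (∃ M : ℝ, ∀ x, a x ≤ M) →
    ∫ η : D X, Real.exp (-(η.integral a)) ∂P = Real.exp (∫ x, Real.log (psi Λ (a x)) ∂ν)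

/-- The cone `C` of non-increasing, non-negative, summable sequences, with the σ-algebra generated
by the coordinates. -/
abbrev Cone : Type := {z : ℕ → ℝ // Antitone z ∧ (∀ i, 0 ≤ z i) ∧ Summable z}

/-- The measure `∑ qᵢ δ_{xᵢ}`, as an ordinary measure. -/
def atomicMeasure {X : Type*} [MeasurableSpace X] (p : Cone × (ℕ → X)) : Measure X :=
  Measure.sum fun i => ENNReal.ofReal (p.1.1 i) • Measure.dirac (p.2 i)

instance isFiniteMeasure_atomicMeasure {X : Type*} [MeasurableSpace X] (p : Cone × (ℕ → X)) :
    IsFiniteMeasure (atomicMeasure p) := by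
  constructor
  simp only [atomicMeasure, Measure.sum_apply _ MeasurableSet.univ, Measure.smul_apply,
    measure_univ, smul_eq_mul, mul_one]
  rw [← ENNReal.ofReal_tsum_of_nonneg p.1.2.2.1 p.1.2.2.2]
  exact ENNReal.ofReal_lt_top

theorem isDiscrete_atomicMeasure {X : Type*} [MeasurableSpace X] (p : Cone × (ℕ → X)) :
    IsDiscrete (atomicMeasure p).toSignedMeasure := by
  refine ⟨p.1.1, p.2, ?_, fun A hA => ?_⟩
  · simpa only [abs_of_nonneg (p.1.2.2.1 _)] using p.1.2.2.2
  · rw [Measure.toSignedMeasure_apply_measurable hA, measureReal_def, atomicMeasure,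
      Measure.sum_apply _ hA, ENNReal.tsum_toReal_eq]
    · refine tsum_congr fun i => ?_
      simp only [Measure.smul_apply, Measure.dirac_apply' _ hA, smul_eq_mul, ENNReal.toReal_mul,
        ENNReal.toReal_ofReal (p.1.2.2.1 i)]
      by_cases h : p.2 i ∈ A <;> simp [h]
    · intro i
      simp only [Measure.smul_apply, Measure.dirac_apply' _ hA, smul_eq_mul]
      by_cases h : p.2 i ∈ A <;> simp [h]

/-- The element `∑ qᵢ δ_{xᵢ}` of `D` built from the charges `q ∈ C` and the points `x ∈ X^∞`. -/
def ofAtoms {X : Type*} [MeasurableSpace X] (p : Cone × (ℕ → X)) : D X :=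
  ⟨(atomicMeasure p).toSignedMeasure, isDiscrete_atomicMeasure p⟩

/-- The charges are positive and the points are distinct: then `∑ qᵢ δ_{xᵢ}` has exactly the atoms
`xᵢ`, with charges `qᵢ`, listed in non-increasing order of charges. -/
def IsProper {X : Type*} (p : Cone × (ℕ → X)) : Prop :=
  (∀ i, 0 < p.1.1 i) ∧ Function.Injective p.2

open Classical in
/-- The conic part of `η`: its charges in non-increasing order. They are uniquely determined by `η`
if `η` is a positive discrete measure with infinitely many atoms; otherwise the value is `0`. -/
def conicPart {X : Type*} [MeasurableSpace X] (η : D X) : Cone :=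
  if h : ∃ p : Cone × (ℕ → X), IsProper p ∧ η = ofAtoms p then h.choose.1
  else ⟨0, fun _ _ _ => le_rfl, fun _ => le_rfl, summable_zero⟩

/-- The conic part of a law `P` on `D`: the distribution of the ordered charges. -/
def conicLaw {X : Type*} [MeasurableSpace X] (P : Measure (D X)) : Measure Cone :=
  P.map conicPart

open Classical in
/-- Exchange the `i`-th and the `j`-th point if their charges are equal. -/
def tieSwap {X : Type*} (i j : ℕ) (p : Cone × (ℕ → X)) : Cone × (ℕ → X) :=
  if p.1.1 i = p.1.1 j then (p.1, p.2 ∘ Equiv.swap i j) else p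

/-- `τ` is the image of `P` under `T : η = ∑ Qᵢ δ_{Xᵢ} ↦ ((Qᵢ), (Xᵢ))`: the law of the sequences of
charges and of locations of the atoms of a process with law `P`, where atoms are listed in
non-increasing order of charges and atoms of equal charge are listed in uniformly random order
(the law does not change when two atoms of equal charge exchange their places in the list). -/
structure IsImageUnderT {X : Type*} [MeasurableSpace X] (P : Measure (D X))
    (τ : Measure (Cone × (ℕ → X))) : Prop where
  isProbabilityMeasure : IsProbabilityMeasure τ
  proper : ∀ᵐ p ∂τ, IsProper p
  map_ofAtoms : τ.map ofAtoms = P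
  map_tieSwap : ∀ i j : ℕ, τ.map (tieSwap i j) = τ

end LevyDecomposition

end

/-! The argument has two halves: the product law is an image of `P` under `T`, and there is at most
one such image.

For the first half, Chernoff bounds from the Laplace functional show that almost every `η` is
positive with infinitely many atoms. Sorting the atoms by charge, with ties broken by position, is
measurable by Lusin–Souslin; let `ρ` be the law of the sorted list. With ties, `ρ` need not be the
product law, so only Laplace functionals are compared. The Laplace functional of `P` depends on `a`
only through the law of `a` under `ν`, so it is unchanged when the points are moved by any
`ν`-preserving `T : X → X`. Such maps are built at random: cut `X` into cells, map each cell to the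
circle so that `ν` conditioned on it becomes Haar measure, rotate every cell by its own independent
uniform angle, and map the circle back to `X` by a map that carries Haar measure to `ν`. As the
cells shrink, the first `m` points fall into different cells, and their images are then exactly
i.i.d. with law `ν`; the remaining charges contribute little. In the limit the Laplace functional of
`ρ` is that of `conicLaw P × ν^∞` (`laplace_eq_laplace_prod`), and Laplace functionals determine
laws on `D` (`map_ofAtoms_eq_of_laplace`).

For the second half, two proper lists of the same `η` differ by a permutation within ties. Ties are
finite, so summing over the tie-preserving permutations of an initial block turns a function of the
list into a function of `η`, while invariance under `tieSwap` controls its integral. Hence `P`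
determines the law of the list (`IsImageUnderT.unique`). -/

noncomputable section

namespace LevyDecomposition

open Filter Topology

/-! ### Discrete measures, their integrals and their atoms. -/

section Discrete

variable {X : Type*} [MeasurableSpace X]

theorem D.ext_apply {η η' : D X}
    (h : ∀ A, MeasurableSet A → η.toSignedMeasure A = η'.toSignedMeasure A) : η = η' := by
  cases η; cases η'
  congr 1
  exact VectorMeasure.ext h

/-- The variation is dominated by `∑ |zᵢ| δ_{xᵢ}`. Finiteness is what gives `D.integral` its
expected value on indicators. -/
theorem IsDiscrete.isFiniteMeasure_variation {m : SignedMeasure X} (hm : IsDiscrete m) :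
    IsFiniteMeasure m.variation := by
  obtain ⟨z, x, hz, h⟩ := hm
  have hle : m.variation ≤ Measure.sum fun i => ENNReal.ofReal |z i| • Measure.dirac (x i) := by
    refine VectorMeasure.variation_le_of_forall_enorm_le fun A hA => ?_
    have hb : ∀ i, |z i * A.indicator (1 : X → ℝ) (x i)| ≤ |z i| := fun i => by
      by_cases hi : x i ∈ A <;> simp [hi]
    have hs : Summable fun i => |z i * A.indicator (1 : X → ℝ) (x i)| :=
      hz.of_nonneg_of_le (fun i => abs_nonneg _) hb
    have h1 : |∑' i, z i * A.indicator (1 : X → ℝ) (x i)| ≤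
        ∑' i, |z i * A.indicator (1 : X → ℝ) (x i)| := by
      simp only [← Real.norm_eq_abs] at hs ⊢
      exact norm_tsum_le_tsum_norm hs
    rw [h A hA, Measure.sum_apply _ hA, Real.enorm_eq_ofReal_abs]
    refine (ENNReal.ofReal_le_ofReal h1).trans ?_
    rw [ENNReal.ofReal_tsum_of_nonneg (fun i => abs_nonneg _) hs]
    refine ENNReal.tsum_le_tsum fun i => ?_
    rw [Measure.smul_apply, Measure.dirac_apply' _ hA, smul_eq_mul]
    by_cases hi : x i ∈ A <;> simp [hi]
  refine ⟨(hle Set.univ).trans_lt ?_⟩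
  rw [Measure.sum_apply _ MeasurableSet.univ]
  simp only [Measure.smul_apply, measure_univ, smul_eq_mul, mul_one]
  rw [← ENNReal.ofReal_tsum_of_nonneg (fun i => abs_nonneg _) hz]
  exact ENNReal.ofReal_lt_top

theorem D.integral_indicator_const (η : D X) {A : Set X} (hA : MeasurableSet A) (t : ℝ) :
    η.integral (A.indicator fun _ => t) = t * η.toSignedMeasure A := by
  have := η.isDiscrete.isFiniteMeasure_variation
  exact VectorMeasure.integral_indicator_const (B := ContinuousLinearMap.lsmul ℝ ℝ) t hA

/-- The sum `∑ qᵢ a(xᵢ)`, the integral of `a` against `∑ qᵢ δ_{xᵢ}`. -/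
def pairing (p : Cone × (ℕ → X)) (a : X → ℝ) : ℝ := ∑' i, p.1.1 i * a (p.2 i)

theorem summable_mul_of_abs_le {q : ℕ → ℝ} (hq : Summable q) (h0 : ∀ i, 0 ≤ q i) {b : ℕ → ℝ} {M : ℝ}
    (hb : ∀ i, |b i| ≤ M) : Summable fun i => q i * b i := by
  refine Summable.of_norm_bounded (hq.mul_right M) fun i => ?_
  rw [norm_mul, Real.norm_of_nonneg (h0 i)]
  exact mul_le_mul_of_nonneg_left (hb i) (h0 i)

theorem integral_ofAtoms [MeasurableSingletonClass X] (p : Cone × (ℕ → X)) {a : X → ℝ}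
    (ha : Measurable a) {M : ℝ} (hM : ∀ x, |a x| ≤ M) : (ofAtoms p).integral a = pairing p a := by
  have h1 : (ofAtoms p).integral a = ∫ x, a x ∂(atomicMeasure p) := by
    rw [← VectorMeasure.integral_toSignedMeasure]
    unfold D.integral ofAtoms
    congr 1
    ext
    simp
  have hint : Integrable a (atomicMeasure p) :=
    Integrable.of_bound ha.aestronglyMeasurable M (ae_of_all _ hM)
  rw [h1]
  refine (hasSum_integral_measure hint).tsum_eq.symm.trans (tsum_congr fun i => ?_)
  rw [integral_smul_measure, integral_dirac, ENNReal.toReal_ofReal (p.1.2.2.1 i), smul_eq_mul]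

theorem ofAtoms_apply (p : Cone × (ℕ → X)) {A : Set X} (hA : MeasurableSet A) :
    (ofAtoms p).toSignedMeasure A = ∑' i, p.1.1 i * A.indicator 1 (p.2 i) := by
  change (atomicMeasure p).toSignedMeasure A = _
  rw [Measure.toSignedMeasure_apply_measurable hA, measureReal_def, atomicMeasure,
    Measure.sum_apply _ hA, ENNReal.tsum_toReal_eq]
  · refine tsum_congr fun i => ?_
    simp only [Measure.smul_apply, Measure.dirac_apply' _ hA, smul_eq_mul, ENNReal.toReal_mul,
      ENNReal.toReal_ofReal (p.1.2.2.1 i)]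
    by_cases h : p.2 i ∈ A <;> simp [h]
  · intro i
    simp only [Measure.smul_apply, Measure.dirac_apply' _ hA, smul_eq_mul]
    by_cases h : p.2 i ∈ A <;> simp [h]

theorem measurable_D_apply {A : Set X} (hA : MeasurableSet A) :
    Measurable fun η : D X => η.toSignedMeasure A := by
  rw [measurable_iff_comap_le, BorelSpace.measurable_eq (α := ℝ)]
  exact le_iSup₂_of_le (f := fun (A : Set X) (_ : MeasurableSet A) =>
    (borel ℝ).comap (fun η : D X => η.toSignedMeasure A)) A hA le_rfl

theorem measurable_to_D {α : Type*} [MeasurableSpace α] {f : α → D X}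
    (hf : ∀ A, MeasurableSet A → Measurable fun y => (f y).toSignedMeasure A) : Measurable f := by
  rw [measurable_iff_comap_le]
  simp only [instMeasurableSpaceD, MeasurableSpace.comap_iSup, iSup_le_iff, MeasurableSpace.comap_comp]
  intro A hA
  have := (hf A hA).comap_le
  rwa [BorelSpace.measurable_eq (α := ℝ)] at this

theorem measurable_pairing {a : X → ℝ} (ha : Measurable a) :
    Measurable fun p : Cone × (ℕ → X) => pairing p a := by
  unfold pairing
  refine Measurable.tsum fun i => ?_
  have h1 : Measurable fun p : Cone × (ℕ → X) => p.1.1 i :=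
    (measurable_pi_apply i).comp (measurable_subtype_coe.comp measurable_fst)
  exact h1.mul (ha.comp (by fun_prop))

theorem ofAtoms_apply_eq_pairing (p : Cone × (ℕ → X)) {A : Set X} (hA : MeasurableSet A) :
    (ofAtoms p).toSignedMeasure A = pairing p (A.indicator 1) := ofAtoms_apply p hA

theorem measurable_ofAtoms : Measurable (ofAtoms : Cone × (ℕ → X) → D X) := by
  refine measurable_to_D fun A hA => ?_
  simp only [ofAtoms_apply_eq_pairing _ hA]
  exact measurable_pairing (measurable_one.indicator hA)

variable [MeasurableSingletonClass X]

/-- Grouping the series by the fibres of `x` merges repeated points. Consequently the masses of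
singletons determine `η`. -/
theorem D.hasSum_apply (η : D X) {A : Set X} (hA : MeasurableSet A) :
    HasSum (fun y => η.toSignedMeasure {y} * A.indicator 1 y) (η.toSignedMeasure A) := by
  obtain ⟨z, x, hz, h⟩ := η.isDiscrete
  have hs : Summable fun i => z i * A.indicator 1 (x i) := by
    refine Summable.of_norm_bounded hz fun i => ?_
    by_cases hi : x i ∈ A <;> simp [hi]
  have h2 := hs.hasSum.tsum_fiberwise x
  rw [← h A hA] at h2
  convert! h2 using 2 with y
  rw [h _ (measurableSet_singleton y)]
  have h3 : ∀ b : x ⁻¹' {y}, z b * A.indicator 1 (x b) = z b * A.indicator (1 : X → ℝ) y := by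
    rintro ⟨b, hb⟩
    rw [Set.mem_preimage, Set.mem_singleton_iff] at hb
    simp [hb]
  rw [tsum_congr h3, tsum_mul_right, tsum_subtype (x ⁻¹' {y}) z]
  congr 1
  refine tsum_congr fun i => ?_
  by_cases hi : x i = y <;> simp [Set.indicator, hi]

theorem D.ext_singleton {η η' : D X}
    (h : ∀ y, η.toSignedMeasure {y} = η'.toSignedMeasure {y}) : η = η' :=
  D.ext_apply fun A hA => by
    have h1 := η.hasSum_apply hA
    simp only [h] at h1
    exact h1.unique (η'.hasSum_apply hA)

theorem D.summable_singleton (η : D X) : Summable fun y => η.toSignedMeasure {y} := by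
  simpa using (η.hasSum_apply MeasurableSet.univ).summable

theorem ofAtoms_singleton {p : Cone × (ℕ → X)} (hp : Function.Injective p.2) (i : ℕ) :
    (ofAtoms p).toSignedMeasure {p.2 i} = p.1.1 i := by
  rw [ofAtoms_apply p (measurableSet_singleton _), tsum_eq_single i]
  · simp
  · intro j hj
    simp [hp.ne hj]

theorem ofAtoms_singleton_of_notMem {p : Cone × (ℕ → X)} {y : X} (hy : y ∉ Set.range p.2) :
    (ofAtoms p).toSignedMeasure {y} = 0 := by
  rw [ofAtoms_apply p (measurableSet_singleton _)]
  convert tsum_zero with i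
  have : p.2 i ≠ y := fun h => hy ⟨i, h⟩
  simp [this]

end Discrete

/-! ### Countable partitions that eventually separate points. -/

section Cells

variable (X : Type*) [MeasurableSpace X] [StandardBorelSpace X]

/-- The index of the cell of `x` in the partition of `X` into preimages of the intervals
`[k / n, (k + 1) / n)` under the standard embedding of `X` into the line. -/
def cellIndex (n : ℕ) (x : X) : ℤ := ⌊(n : ℝ) * embeddingReal X x⌋

variable {X}

theorem measurable_cellIndex (n : ℕ) : Measurable (cellIndex X n) :=
  Int.measurable_floor.comp ((measurable_embeddingReal X).const_mul (n : ℝ))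

theorem eventually_cellIndex_ne {x y : X} (h : x ≠ y) :
    ∀ᶠ n in atTop, cellIndex X n x ≠ cellIndex X n y := by
  have hne : embeddingReal X x - embeddingReal X y ≠ 0 :=
    sub_ne_zero.mpr ((measurableEmbedding_embeddingReal X).injective.ne h)
  have ht : Tendsto (fun n : ℕ => (n : ℝ) * |embeddingReal X x - embeddingReal X y|) atTop atTop :=
    tendsto_natCast_atTop_atTop.atTop_mul_const (abs_pos.mpr hne)
  filter_upwards [ht.eventually_ge_atTop 1] with n hn heq
  have := Int.abs_sub_lt_one_of_floor_eq_floor heq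
  rw [← mul_sub, abs_mul, Nat.abs_cast] at this
  linarith

/-- The cell with index `k` of the `n`-th partition. -/
def cell (X : Type*) [MeasurableSpace X] [StandardBorelSpace X] (n : ℕ) (k : ℤ) : Set X :=
  cellIndex X n ⁻¹' {k}

theorem measurableSet_cell (n : ℕ) (k : ℤ) : MeasurableSet (cell X n k) :=
  measurable_cellIndex n (measurableSet_singleton k)

/-- Every atom other than `x` eventually leaves the cell of `x`; dominated convergence with bound
`|zᵢ|` does the rest. -/
theorem D.tendsto_cell (η : D X) (x : X) :
    Tendsto (fun n => η.toSignedMeasure (cell X n (cellIndex X n x))) atTop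
      (𝓝 (η.toSignedMeasure {x})) := by
  obtain ⟨z, y, hz, h⟩ := η.isDiscrete
  simp only [h _ (measurableSet_cell _ _), h _ (measurableSet_singleton x)]
  refine tendsto_tsum_of_dominated_convergence hz (fun i => ?_) (Eventually.of_forall fun n i => ?_)
  · by_cases hi : y i = x
    · simp [cell, hi]
    · refine tendsto_const_nhds.congr' ?_
      filter_upwards [eventually_cellIndex_ne hi] with n hn
      simp [cell, hi, hn]
  · by_cases hi : y i ∈ cell X n (cellIndex X n x) <;> simp [hi]

/-- The values of `η` on all cells. -/
def cellValues (η : D X) : ℕ × ℤ → ℝ := fun k => η.toSignedMeasure (cell X k.1 k.2)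

theorem measurable_cellValues : Measurable (cellValues : D X → ℕ × ℤ → ℝ) :=
  measurable_pi_lambda _ fun _ => measurable_D_apply (measurableSet_cell _ _)

/-- Countably many evaluations separate the points of `D X`. This stands in for a standard Borel
structure on `D X` itself. -/
theorem injective_cellValues : Function.Injective (cellValues : D X → ℕ × ℤ → ℝ) := by
  intro η η' h
  refine D.ext_singleton fun x => tendsto_nhds_unique (η.tendsto_cell x) ?_
  convert η'.tendsto_cell x using 2 with n
  exact congrFun h (n, cellIndex X n x)

end Cells

/-! ### Enumerating a set by a key, and rearranging antitone sequences. -/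

section Order

/-- The number of predecessors is a strictly monotone rank with values in an infinite subset of `ℕ`,
and such a subset is order isomorphic to `ℕ`. -/
theorem exists_bijective_strictMono {T K : Type*} [Infinite T] [LinearOrder K] (key : T → K)
    (hkey : Function.Injective key) (hfin : ∀ t, {t' | key t' < key t}.Finite) :
    ∃ x : ℕ → T, Function.Bijective x ∧ StrictMono (key ∘ x) := by
  set rank : T → ℕ := fun t => {t' | key t' < key t}.ncard
  have hrank : ∀ t t', key t < key t' → rank t < rank t' := fun t t' h =>
    Set.ncard_lt_ncard ⟨fun u hu => lt_trans hu h, fun hs => lt_irrefl _ (hs h)⟩ (hfin t')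
  have hinj : Function.Injective rank := fun t t' h => by
    by_contra hne
    rcases lt_or_gt_of_ne (hkey.ne hne) with h1 | h1
    · exact (hrank _ _ h1).ne h
    · exact (hrank _ _ h1).ne' h
  have : Infinite (Set.range rank) := (Set.infinite_range_of_injective hinj).to_subtype
  set x : ℕ → T := fun n => (Equiv.ofInjective rank hinj).symm (Nat.Subtype.orderIsoOfNat _ n)
  have hx : ∀ n, rank (x n) = Nat.Subtype.orderIsoOfNat (Set.range rank) n := fun n =>
    Equiv.apply_ofInjective_symm hinj _
  refine ⟨x, ((Nat.Subtype.orderIsoOfNat _).toEquiv.trans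
    (Equiv.ofInjective rank hinj).symm).bijective, fun m n hmn => ?_⟩
  have h1 : rank (x m) < rank (x n) := by
    rw [hx, hx]
    exact (Nat.Subtype.orderIsoOfNat (Set.range rank)).strictMono hmn
  by_contra hle
  rcases (not_lt.mp hle).lt_or_eq with h2 | h2
  · exact lt_asymm h1 (hrank _ _ h2)
  · exact h1.ne' (congrArg rank (hkey h2))

theorem comp_perm_eq_of_antitone {q : ℕ → ℝ} {π : Equiv.Perm ℕ} (hq : Antitone q)
    (hπ : Antitone (q ∘ π)) : q ∘ π = q := by
  have key : ∀ (q : ℕ → ℝ) (π : Equiv.Perm ℕ), Antitone q → Antitone (q ∘ π) →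
      ∀ n, (q ∘ π) n ≤ q n := by
    intro q π hq hπ n
    obtain ⟨i, hi, hni⟩ : ∃ i ≤ n, n ≤ π i := by
      -- Pigeonhole: otherwise `π` would inject the `n + 1` indices `i ≤ n` into the `n` indices
      -- below `n`.
      by_contra! h
      have : (Finset.Iic n).card ≤ (Finset.Iio n).card :=
        Finset.card_le_card_of_injOn π (fun i hi => by simpa using h i (by simpa using hi))
          π.injective.injOn
      simp at this
    exact (hπ hi).trans (hq hni)
  refine funext fun n => le_antisymm (key q π hq hπ n) ?_
  simpa [Function.comp_assoc] using key (q ∘ π) π⁻¹ hπ (by simpa [Function.comp_def] using hq) n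

end Order

/-! ### Measurability of charges and points. -/

section Coordinates

variable {X : Type*} [MeasurableSpace X]

theorem measurable_charge (i : ℕ) : Measurable fun p : Cone × (ℕ → X) => p.1.1 i :=
  (measurable_pi_apply i).comp (measurable_subtype_coe.comp measurable_fst)

theorem measurable_point (i : ℕ) : Measurable fun p : Cone × (ℕ → X) => p.2 i :=
  (measurable_pi_apply i).comp measurable_snd

end Coordinates

/-! ### Proper lists of the same measure differ by a permutation within ties. -/

section Proper

variable {X : Type*} [MeasurableSpace X] [MeasurableSingletonClass X]

theorem IsProper.range_eq {p : Cone × (ℕ → X)} (hp : IsProper p) :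
    Set.range p.2 = {y | (ofAtoms p).toSignedMeasure {y} ≠ 0} := by
  ext y
  refine ⟨?_, fun h => by_contra fun hy => h (ofAtoms_singleton_of_notMem hy)⟩
  rintro ⟨i, rfl⟩
  rw [Set.mem_ofPred_eq, ofAtoms_singleton hp.2]
  exact (hp.1 i).ne'

/-- Both lists enumerate the set of atoms injectively, which yields `π`. Since both charge sequences
are antitone, `comp_perm_eq_of_antitone` makes them equal. -/
theorem IsProper.exists_perm {p p' : Cone × (ℕ → X)} (hp : IsProper p) (hp' : IsProper p')
    (h : ofAtoms p = ofAtoms p') :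
    ∃ π : Equiv.Perm ℕ, p'.1 = p.1 ∧ p'.2 = p.2 ∘ π ∧ p.1.1 ∘ π = p.1.1 := by
  have hr : Set.range p'.2 = Set.range p.2 := by rw [hp.range_eq, hp'.range_eq, h]
  set π : Equiv.Perm ℕ := ((Equiv.ofInjective p'.2 hp'.2).trans (Equiv.setCongr hr)).trans
    (Equiv.ofInjective p.2 hp.2).symm
  have hx : p'.2 = p.2 ∘ π := by
    funext i
    exact (Equiv.apply_ofInjective_symm hp.2 (Equiv.setCongr hr (Equiv.ofInjective p'.2 hp'.2 i))).symm
  have hq : p'.1.1 = p.1.1 ∘ π := by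
    funext i
    rw [← ofAtoms_singleton hp'.2, hx, ← h]
    exact ofAtoms_singleton hp.2 (π i)
  have hπ : p.1.1 ∘ π = p.1.1 :=
    comp_perm_eq_of_antitone p.1.2.1 (by rw [← hq]; exact p'.1.2.1)
  exact ⟨π, Subtype.ext (hq.trans hπ), hx, hπ⟩

theorem conicPart_ofAtoms {p : Cone × (ℕ → X)} (hp : IsProper p) : conicPart (ofAtoms p) = p.1 := by
  have h : ∃ p' : Cone × (ℕ → X), IsProper p' ∧ ofAtoms p = ofAtoms p' := ⟨p, hp, rfl⟩
  rw [conicPart, dif_pos h]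
  obtain ⟨π, h1, -⟩ := hp.exists_perm h.choose_spec.1 h.choose_spec.2
  exact h1

end Proper

/-! ### The canonical order of atoms and its measurability. -/

section Canonical

variable {X : Type*} [MeasurableSpace X] [StandardBorelSpace X]

/-- The key by which atoms are sorted: by decreasing charge, ties being broken by the position. -/
def atomKey (X : Type*) [MeasurableSpace X] [StandardBorelSpace X] (z : ℝ) (y : X) : ℝ ×ₗ ℝ :=
  toLex (-z, embeddingReal X y)

/-- `p` is proper, and atoms of equal charge are listed in increasing order of position. -/
def IsCanonical (p : Cone × (ℕ → X)) : Prop :=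
  IsProper p ∧ StrictMono fun i => atomKey X (p.1.1 i) (p.2 i)

theorem atomKey_lt {z z' : ℝ} {y y' : X} : atomKey X z y < atomKey X z' y' ↔
    z' < z ∨ z = z' ∧ embeddingReal X y < embeddingReal X y' := by
  simp [atomKey, Prod.Lex.toLex_lt_toLex]

theorem atomKey_inj {z z' : ℝ} {y y' : X} : atomKey X z y = atomKey X z' y' ↔ z = z' ∧ y = y' := by
  simp [atomKey, (measurableEmbedding_embeddingReal X).injective.eq_iff]

theorem measurableSet_isProper : MeasurableSet {p : Cone × (ℕ → X) | IsProper p} := by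
  have : {p : Cone × (ℕ → X) | IsProper p} =
      (⋂ i, {p | 0 < p.1.1 i}) ∩ ⋂ (i) (j) (_ : i ≠ j), {p | p.2 i = p.2 j}ᶜ := by
    ext p
    simp only [IsProper, Set.mem_ofPred_eq, Set.mem_inter_iff, Set.mem_iInter, Set.mem_compl_iff,
      Function.Injective]
    refine and_congr_right fun _ => ⟨fun h i j hij he => hij (h he), fun h i j he => ?_⟩
    by_contra hij
    exact h i j hij he
  rw [this]
  refine (MeasurableSet.iInter fun i => measurableSet_lt measurable_const (measurable_charge i)).inter
    (MeasurableSet.iInter fun i => MeasurableSet.iInter fun j => MeasurableSet.iInter fun _ => ?_)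
  exact (measurableSet_eq_fun (measurable_point i) (measurable_point j)).compl

theorem measurableSet_isCanonical : MeasurableSet {p : Cone × (ℕ → X) | IsCanonical p} := by
  have : {p : Cone × (ℕ → X) | IsCanonical p} = {p | IsProper p} ∩
      ⋂ i, ({p | p.1.1 (i + 1) < p.1.1 i} ∪ {p | p.1.1 i = p.1.1 (i + 1)} ∩
        {p | embeddingReal X (p.2 i) < embeddingReal X (p.2 (i + 1))}) := by
    ext p
    simp only [IsCanonical, Set.mem_ofPred_eq, Set.mem_inter_iff, Set.mem_iInter, Set.mem_union,
      ← atomKey_lt]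
    exact and_congr_right fun _ => ⟨fun h i => h (Nat.lt_succ_self i), strictMono_nat_of_lt_succ⟩
  rw [this]
  refine measurableSet_isProper.inter (MeasurableSet.iInter fun i => ?_)
  have hX := measurable_embeddingReal X
  exact (measurableSet_lt (measurable_charge _) (measurable_charge _)).union
    ((measurableSet_eq_fun (measurable_charge _) (measurable_charge _)).inter
      (measurableSet_lt (hX.comp (measurable_point _)) (hX.comp (measurable_point _))))

/-- A strictly increasing sequence is determined by its range, and the set of keys can be read off
from the measure. -/
theorem IsCanonical.eq_of_ofAtoms_eq {p p' : Cone × (ℕ → X)} (hp : IsCanonical p)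
    (hp' : IsCanonical p') (h : ofAtoms p = ofAtoms p') : p = p' := by
  have hr : ∀ p : Cone × (ℕ → X), IsProper p →
      Set.range (fun i => atomKey X (p.1.1 i) (p.2 i)) =
      (fun y => atomKey X ((ofAtoms p).toSignedMeasure {y}) y) ''
        {y | (ofAtoms p).toSignedMeasure {y} ≠ 0} := fun p hp => by
    rw [← hp.range_eq, ← Set.range_comp]
    refine congrArg Set.range (funext fun i => ?_)
    rw [Function.comp_apply, ofAtoms_singleton hp.2]
  have he := (hp.2.range_inj hp'.2).mp (by rw [hr p hp.1, hr p' hp'.1, h])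
  have hi := fun i => atomKey_inj.mp (congrFun he i)
  exact Prod.ext (Subtype.ext (funext fun i => (hi i).1)) (funext fun i => (hi i).2)

theorem D.exists_isCanonical {η : D X} (h0 : ∀ y, 0 ≤ η.toSignedMeasure {y})
    (hinf : {y | 0 < η.toSignedMeasure {y}}.Infinite) : ∃ p, IsCanonical p ∧ ofAtoms p = η := by
  set w : X → ℝ := fun y => η.toSignedMeasure {y}
  have hw : Summable w := η.summable_singleton
  have : Infinite {y | 0 < w y} := hinf.to_subtype
  obtain ⟨x, hx, hmono⟩ := exists_bijective_strictMono (T := {y | 0 < w y})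
    (fun y => atomKey X (w y) y) (fun y y' h => Subtype.ext (atomKey_inj.mp h).2) fun t => by
      -- Summability leaves only finitely many atoms with charge at least `w t`, hence finitely many
      -- predecessors in the key order.
      have hev := hw.tendsto_cofinite_zero.eventually (gt_mem_nhds t.2)
      have hfin : {y | ¬ w y < w t}.Finite := hev
      refine (hfin.preimage (f := ((↑) : {y | 0 < w y} → X))
        Subtype.val_injective.injOn).subset fun y hy => ?_
      rcases atomKey_lt.mp hy with h | h
      · exact not_lt.mpr h.le
      · exact not_lt.mpr h.1.ge
  have hinj : Function.Injective fun i => (x i : X) := Subtype.val_injective.comp hx.1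
  have hanti : Antitone fun i => w (x i) := fun i j hij => by
    rcases hij.lt_or_eq with h | rfl
    · rcases atomKey_lt.mp (hmono h) with h | h
      · exact h.le
      · exact h.1.ge
    · exact le_rfl
  let p : Cone × (ℕ → X) := ⟨⟨fun i => w (x i), hanti, fun i => h0 _, hw.comp_injective hinj⟩,
    fun i => x i⟩
  have hp : IsProper p := ⟨fun i => (x i).2, hinj⟩
  refine ⟨p, ⟨hp, hmono⟩, D.ext_singleton fun y => ?_⟩
  by_cases hy : 0 < w y
  · obtain ⟨i, hi⟩ := hx.2 ⟨y, hy⟩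
    have : y = p.2 i := by simp [p, hi]
    rw [this, ofAtoms_singleton hp.2]
  · rw [ofAtoms_singleton_of_notMem]
    · exact le_antisymm (h0 y) (not_lt.mp hy)
    · rintro ⟨i, rfl⟩
      exact hy (x i).2

theorem measurableSet_cone : MeasurableSet {z : ℕ → ℝ | Antitone z ∧ (∀ i, 0 ≤ z i) ∧ Summable z} := by
  have h1 : MeasurableSet {z : ℕ → ℝ | Antitone z} := by
    have : {z : ℕ → ℝ | Antitone z} = ⋂ i, {z | z (i + 1) ≤ z i} := by
      ext z
      simp only [Set.mem_ofPred_eq, Set.mem_iInter]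
      exact ⟨fun h i => h (Nat.le_succ i), antitone_nat_of_succ_le⟩
    rw [this]
    exact MeasurableSet.iInter fun i =>
      measurableSet_le (measurable_pi_apply _) (measurable_pi_apply _)
  have h2 : MeasurableSet {z : ℕ → ℝ | ∀ i, 0 ≤ z i} := by
    simp only [Set.ofPred_forall]
    exact MeasurableSet.iInter fun i => measurableSet_le measurable_const (measurable_pi_apply _)
  have h3 : MeasurableSet {z : ℕ → ℝ | ∑' i, ENNReal.ofReal (z i) < ∞} :=
    measurableSet_lt (Measurable.tsum fun i => (measurable_pi_apply i).ennreal_ofReal)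
      measurable_const
  have : {z : ℕ → ℝ | Antitone z ∧ (∀ i, 0 ≤ z i) ∧ Summable z} = {z | Antitone z} ∩
      ({z | ∀ i, 0 ≤ z i} ∩ {z | ∑' i, ENNReal.ofReal (z i) < ∞}) := by
    ext z
    simp only [Set.mem_ofPred_eq, Set.mem_inter_iff]
    refine and_congr_right fun _ => and_congr_right fun h0 => ⟨fun h => ?_, fun h => ?_⟩
    · rw [← ENNReal.ofReal_tsum_of_nonneg h0 h]
      exact ENNReal.ofReal_lt_top
    · have := ENNReal.summable_toReal h.ne
      simpa only [ENNReal.toReal_ofReal (h0 _)] using this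
  rw [this]
  exact h1.inter (h2.inter h3)

instance standardBorelSpace_cone : StandardBorelSpace Cone := measurableSet_cone.standardBorel

/-- Lusin–Souslin: a measurable injection from a standard Borel space into a countably separated one
is a measurable embedding. -/
theorem measurableEmbedding_cellValues_canonical :
    MeasurableEmbedding fun p : {p : Cone × (ℕ → X) | IsCanonical p} => cellValues (ofAtoms p.1) := by
  have : StandardBorelSpace {p : Cone × (ℕ → X) | IsCanonical p} :=
    measurableSet_isCanonical.standardBorel
  refine Measurable.measurableEmbedding
    (measurable_cellValues.comp (measurable_ofAtoms.comp measurable_subtype_coe)) fun p p' h => ?_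
  exact Subtype.ext (p.2.eq_of_ofAtoms_eq p'.2 (injective_cellValues h))

/-- The inverse of the embedding, extended by a constant off its range, gives a measurable way to
list the atoms. -/
theorem exists_measurable_sort [Nonempty X] : ∃ s : D X → Cone × (ℕ → X), Measurable s ∧
    ∀ p, IsCanonical p → s (ofAtoms p) = p := by
  obtain ⟨g, hg, h⟩ := (measurableEmbedding_cellValues_canonical (X := X)).exists_measurable_extend
    measurable_subtype_coe fun _ => ⟨⟨⟨0, fun _ _ _ => le_rfl, fun _ => le_rfl, summable_zero⟩,
      fun _ => Classical.arbitrary X⟩⟩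
  exact ⟨g ∘ cellValues, hg.comp measurable_cellValues, fun p hp => congrFun h ⟨p, hp⟩⟩

end Canonical

/-! ### Laplace transforms determine finite measures on an orthant. -/

section Laplace

open scoped BoundedContinuousFunction

variable {I : Type*} [Fintype I]

/-- The bounded continuous function `x ↦ exp(-∑ tᵢ xᵢ)` on the non-negative orthant. -/
def expNeg (t : I → ℝ≥0) : (I → ℝ≥0) →ᵇ ℝ :=
  BoundedContinuousFunction.ofNormedAddCommGroup (fun x => Real.exp (-∑ i, (t i : ℝ) * x i))
    (by fun_prop) 1 fun x => by
      rw [Real.norm_eq_abs, Real.abs_exp, Real.exp_le_one_iff, neg_nonpos]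
      positivity

theorem expNeg_apply (t x : I → ℝ≥0) : expNeg t x = Real.exp (-∑ i, (t i : ℝ) * x i) := rfl

/-- The exponentials `expNeg t` form a multiplicative monoid. -/
def expNegMonoid (I : Type*) [Fintype I] : Submonoid ((I → ℝ≥0) →ᵇ ℝ) where
  carrier := Set.range expNeg
  one_mem' := ⟨0, by ext; simp [expNeg_apply]⟩
  mul_mem' := by
    rintro _ _ ⟨s, rfl⟩ ⟨t, rfl⟩
    refine ⟨s + t, ?_⟩
    ext x
    simp only [BoundedContinuousFunction.coe_mul, Pi.mul_apply, expNeg_apply, ← Real.exp_add,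
      Pi.add_apply, NNReal.coe_add, add_mul, Finset.sum_add_distrib, neg_add]

/-- The exponentials are closed under products, so their linear span is a subalgebra. It separates
points, hence determines finite measures. -/
theorem measure_ext_of_laplace {μ μ' : Measure (I → ℝ≥0)} [IsFiniteMeasure μ] [IsFiniteMeasure μ']
    (h : ∀ t : I → ℝ≥0, ∫ x, Real.exp (-∑ i, (t i : ℝ) * x i) ∂μ =
      ∫ x, Real.exp (-∑ i, (t i : ℝ) * x i) ∂μ') : μ = μ' := by
  classical
  let A : StarSubalgebra ℝ ((I → ℝ≥0) →ᵇ ℝ) :=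
    { Algebra.adjoin ℝ (expNegMonoid I : Set ((I → ℝ≥0) →ᵇ ℝ)) with
      star_mem' := fun {a} ha => by
        have : star a = a := by ext; simp
        rwa [this] }
  have hmem : ∀ f, f ∈ A ↔ f ∈ Submodule.span ℝ (expNegMonoid I : Set ((I → ℝ≥0) →ᵇ ℝ)) := by
    intro f
    change f ∈ Algebra.adjoin ℝ (expNegMonoid I : Set ((I → ℝ≥0) →ᵇ ℝ)) ↔ _
    rw [← Subalgebra.mem_toSubmodule, Algebra.adjoin_eq_span, Submonoid.closure_eq]
  refine ext_of_forall_mem_subalgebra_integral_eq_of_polish (A := A) ?_ ?_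
  · intro x y hxy
    obtain ⟨i, hi⟩ := Function.ne_iff.mp hxy
    refine ⟨expNeg (Pi.single i 1), ⟨_, ⟨expNeg (Pi.single i 1),
      (hmem _).mpr (Submodule.subset_span ⟨_, rfl⟩), rfl⟩, rfl⟩, ?_⟩
    have hs : ∀ x : I → ℝ≥0, expNeg (Pi.single i 1) x = Real.exp (-(x i : ℝ)) := fun x => by
      rw [expNeg_apply, Finset.sum_eq_single i]
      · simp
      · intro j _ hj
        simp [hj]
      · simp
    rw [hs, hs]
    simpa using hi
  · intro g hg
    rw [hmem] at hg
    induction hg using Submodule.span_induction with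
    | mem f hf =>
      obtain ⟨t, rfl⟩ := hf
      exact h t
    | zero => simp
    | add f g _ _ hf hg =>
      simp only [BoundedContinuousFunction.coe_add, Pi.add_apply]
      rw [integral_add (f.integrable μ) (g.integrable μ),
        integral_add (f.integrable μ') (g.integrable μ'), hf, hg]
    | smul c f _ hf =>
      simp only [BoundedContinuousFunction.coe_smul, integral_smul, hf]

end Laplace

/-! ### Laplace functionals determine laws on `D`. -/

section Uniqueness

theorem pairing_nonneg {X : Type*} (p : Cone × (ℕ → X)) {a : X → ℝ} (ha : ∀ x, 0 ≤ a x) : 0 ≤ pairing p a :=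
  tsum_nonneg fun i => mul_nonneg (p.1.2.2.1 i) (ha _)

variable {X : Type*} [MeasurableSpace X]

/-- For `a = ∑ tᵢ 1_{Aᵢ}` the functional is the multivariate Laplace transform of the values on the
`Aᵢ`. So all finite-dimensional laws of the evaluations agree, and the evaluations generate the
σ-algebra of `D X`. -/
theorem map_ofAtoms_eq_of_laplace {τ τ' : Measure (Cone × (ℕ → X))} [IsProbabilityMeasure τ]
    [IsProbabilityMeasure τ']
    (h : ∀ a : X → ℝ, Measurable a → (∀ x, 0 ≤ a x) → (∃ M : ℝ, ∀ x, a x ≤ M) →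
      ∫ p, Real.exp (-pairing p a) ∂τ = ∫ p, Real.exp (-pairing p a) ∂τ') :
    τ.map ofAtoms = τ'.map ofAtoms := by
  set ev : Cone × (ℕ → X) → ({A : Set X // MeasurableSet A} → ℝ≥0) :=
    fun p A => (pairing p (A.1.indicator 1)).toNNReal
  have hev : Measurable ev := measurable_pi_lambda _ fun A =>
    (measurable_pairing (measurable_one.indicator A.2)).real_toNNReal
  have hcoe : ∀ p A, (ev p A : ℝ) = pairing p (A.1.indicator 1) := fun p A =>
    Real.coe_toNNReal _ (pairing_nonneg p fun x => Set.indicator_nonneg (fun _ _ => zero_le_one) x)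
  have hfin : ∀ I : Finset {A : Set X // MeasurableSet A},
      (τ.map ev).map I.restrict = (τ'.map ev).map I.restrict := by
    intro I
    have hI : Measurable (I.restrict (π := fun _ => ℝ≥0)) := Finset.measurable_restrict I
    have := Measure.isProbabilityMeasure_map (μ := τ) hev.aemeasurable
    have := Measure.isProbabilityMeasure_map (μ := τ') hev.aemeasurable
    refine measure_ext_of_laplace fun t => ?_
    have hm : Measurable fun x : I → ℝ≥0 => Real.exp (-∑ i, (t i : ℝ) * x i) := by fun_prop
    rw [Measure.map_map hI hev, Measure.map_map hI hev,
      integral_map (hI.comp hev).aemeasurable hm.aestronglyMeasurable,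
      integral_map (hI.comp hev).aemeasurable hm.aestronglyMeasurable]
    have hp : ∀ p, ∑ i : I, (t i : ℝ) * ((I.restrict ∘ ev) p i : ℝ) =
        pairing p fun x => ∑ i : I, (t i : ℝ) * i.1.1.indicator 1 x := by
      intro p
      simp only [Function.comp_apply, Finset.restrict, hcoe, pairing, Finset.mul_sum]
      rw [Summable.tsum_finsetSum]
      · refine Finset.sum_congr rfl fun i _ => ?_
        rw [← tsum_mul_left]
        exact tsum_congr fun j => by ring
      · intro i _
        refine summable_mul_of_abs_le p.1.2.2.2 p.1.2.2.1 (M := t i) fun j => ?_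
        by_cases hj : p.2 j ∈ i.1.1 <;> simp [hj]
    simp only [hp]
    refine h _ ?_ (fun x => ?_) ⟨∑ i : I, (t i : ℝ), fun x => ?_⟩
    · exact Finset.measurable_sum _ fun i _ => (measurable_one.indicator i.1.2).const_mul _
    · exact Finset.sum_nonneg fun i _ => mul_nonneg (t i).2
        (Set.indicator_nonneg (fun _ _ => zero_le_one) x)
    · refine Finset.sum_le_sum fun i _ => mul_le_of_le_one_right (t i).2 ?_
      exact Set.indicator_le_self' (fun _ _ => zero_le_one) x
  have hmap : τ.map ev = τ'.map ev := by
    have := Measure.isProbabilityMeasure_map (μ := τ') hev.aemeasurable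
    have h1 : ∀ I : Finset {A : Set X // MeasurableSet A},
        IsFiniteMeasure ((τ'.map ev).map (I.restrict (π := fun _ => ℝ≥0))) := fun I => inferInstance
    exact IsProjectiveLimit.unique (P := fun I => (τ'.map ev).map I.restrict) hfin fun I => rfl
  have hle : (instMeasurableSpaceD X).comap ofAtoms ≤ MeasurableSpace.pi.comap ev := by
    simp only [instMeasurableSpaceD, MeasurableSpace.comap_iSup, iSup_le_iff,
      MeasurableSpace.comap_comp]
    intro A hA
    have h1 : (fun η : D X => η.toSignedMeasure A) ∘ ofAtoms = (fun y => (y ⟨A, hA⟩ : ℝ)) ∘ ev := by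
      funext p
      exact (ofAtoms_apply_eq_pairing p hA).trans (hcoe p ⟨A, hA⟩).symm
    rw [h1, ← MeasurableSpace.comap_comp, ← BorelSpace.measurable_eq (α := ℝ)]
    refine MeasurableSpace.comap_mono (Measurable.comap_le ?_)
    fun_prop
  ext B hB
  rw [Measure.map_apply measurable_ofAtoms hB, Measure.map_apply measurable_ofAtoms hB]
  obtain ⟨C, hC, hCB⟩ := hle _ ⟨B, hB, rfl⟩
  rw [← hCB, ← Measure.map_apply hev hC, ← Measure.map_apply hev hC, hmap]

end Uniqueness

/-! ### Transport between `ν`, the unit interval and the circle. -/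

section Uniform

theorem continuous_cdf (μ : Measure ℝ) [IsProbabilityMeasure μ] [NullSingletonClass μ] :
    Continuous (cdf μ) := by
  refine continuous_iff_continuousAt.mpr fun x => ?_
  have hl : Function.leftLim (cdf μ) x = cdf μ x := by
    have h1 : (cdf μ).measure {x} = 0 := by rw [measure_cdf]; exact measure_singleton x
    rw [StieltjesFunction.measure_singleton, ENNReal.ofReal_eq_zero, sub_nonpos] at h1
    exact le_antisymm ((monotone_cdf μ).leftLim_le le_rfl) h1
  rw [(monotone_cdf μ).continuousAt_iff_leftLim_eq_rightLim, hl, StieltjesFunction.rightLim_eq]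

theorem measure_cdf_le (μ : Measure ℝ) [IsProbabilityMeasure μ] [NullSingletonClass μ] {t : ℝ}
    (h0 : 0 < t) (h1 : t < 1) : μ {x | cdf μ x ≤ t} = ENNReal.ofReal t := by
  obtain ⟨x₀, hx₀⟩ : ∃ x, cdf μ x = t :=
    mem_range_of_exists_le_of_exists_ge (continuous_cdf μ)
      ((tendsto_cdf_atBot μ).eventually (ge_mem_nhds h0)).exists
      ((tendsto_cdf_atTop μ).eventually (le_mem_nhds h1)).exists
  obtain ⟨b, hb⟩ : ∃ b, t < cdf μ b := ((tendsto_cdf_atTop μ).eventually (lt_mem_nhds h1)).exists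
  have hbdd : BddAbove {x | cdf μ x ≤ t} :=
    ⟨b, fun x hx => le_of_not_gt fun h => (hb.trans_le (monotone_cdf μ h.le)).not_ge hx⟩
  have hmem : sSup {x | cdf μ x ≤ t} ∈ {x | cdf μ x ≤ t} :=
    (isClosed_le (continuous_cdf μ) continuous_const).csSup_mem ⟨x₀, hx₀.le⟩ hbdd
  have hset : {x | cdf μ x ≤ t} = Set.Iic (sSup {x | cdf μ x ≤ t}) :=
    Set.ext fun x => ⟨fun hx => le_csSup hbdd hx, fun hx => (monotone_cdf μ hx).trans hmem⟩
  have heq : cdf μ (sSup {x | cdf μ x ≤ t}) = t :=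
    le_antisymm hmem (hx₀.ge.trans (monotone_cdf μ (le_csSup hbdd hx₀.le)))
  rw [hset, ← ofReal_cdf μ, heq]

/-- The probability integral transform: without atoms the distribution function is continuous and
takes every level in `(0, 1)`. -/
theorem map_cdf (μ : Measure ℝ) [IsProbabilityMeasure μ] [NullSingletonClass μ] :
    μ.map (cdf μ) = volume.restrict (Set.Ioc 0 1) := by
  have hm : Measurable (cdf μ) := (continuous_cdf μ).measurable
  have := Measure.isProbabilityMeasure_map (μ := μ) hm.aemeasurable
  refine Measure.ext_of_Iic _ _ fun t => ?_
  rw [Measure.map_apply hm measurableSet_Iic, Measure.restrict_apply measurableSet_Iic]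
  change μ {x | cdf μ x ≤ t} = _
  rcases le_or_gt 1 t with h1 | h1
  · have e1 : {x | cdf μ x ≤ t} = Set.univ := Set.eq_univ_of_forall fun x => (cdf_le_one μ x).trans h1
    have e2 : Set.Iic t ∩ Set.Ioc (0 : ℝ) 1 = Set.Ioc 0 1 :=
      Set.inter_eq_right.mpr fun x hx => hx.2.trans h1
    rw [e1, e2]
    simp
  rcases le_or_gt t 0 with h0 | h0
  · have e2 : Set.Iic t ∩ Set.Ioc (0 : ℝ) 1 = ∅ :=
      Set.eq_empty_of_forall_notMem fun x hx => (hx.2.1.trans_le (hx.1.trans h0)).false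
    rw [e2, measure_empty, ← nonpos_iff_eq_zero]
    -- The level `t ≤ 0` may not be attained, so its sublevel set is bounded by those of levels `s ↓
    -- 0`.
    refine ge_of_tendsto (f := fun s : ℝ => ENNReal.ofReal s) (x := 𝓝[>] 0) ?_ ?_
    · have := (ENNReal.continuous_ofReal.tendsto 0).mono_left (nhdsWithin_le_nhds (s := Set.Ioi (0 : ℝ)))
      simpa using this
    · filter_upwards [Ioo_mem_nhdsGT (zero_lt_one (α := ℝ))] with s hs
      rw [← measure_cdf_le μ hs.1 hs.2]
      exact measure_mono fun x hx => le_trans hx (h0.trans hs.1.le)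
  · have e2 : Set.Iic t ∩ Set.Ioc (0 : ℝ) 1 = Set.Ioc 0 t := by
      ext x
      simp only [Set.mem_inter_iff, Set.mem_Iic, Set.mem_Ioc]
      exact ⟨fun h => ⟨h.2.1, h.1⟩, fun h => ⟨h.2, h.1, h.2.trans h1.le⟩⟩
    rw [e2, Real.volume_Ioc, sub_zero, measure_cdf_le μ h0 h1]

/-- On each fibre of `π` the map `S` is uniform and independent of the angle chosen there, so
rotation invariance of Haar measure applies fibre by fibre. -/
theorem measurePreserving_add_fiberwise {X : Type*} [MeasurableSpace X] {ν : Measure X} [IsProbabilityMeasure ν]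
    {π : X → ℤ} (hπ : Measurable π) {S : X → UnitAddCircle} (hS : Measurable S)
    (h : ∀ k B, MeasurableSet B → ν (π ⁻¹' {k} ∩ S ⁻¹' B) = ν (π ⁻¹' {k}) * volume B)
    (θ : ℤ → UnitAddCircle) : MeasurePreserving (fun x => S x + θ (π x)) ν volume := by
  have hm : Measurable fun x => S x + θ (π x) := hS.add ((measurable_of_countable θ).comp hπ)
  refine ⟨hm, Measure.ext fun B hB => ?_⟩
  have hk : ∀ k, MeasurableSet (π ⁻¹' {k}) := fun k => hπ (measurableSet_singleton k)
  have hsum : ∀ A, MeasurableSet A → ν A = ∑' k, ν (π ⁻¹' {k} ∩ A) := fun A hA => by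
    rw [← measure_iUnion (fun i j hij => ?_) fun k => (hk k).inter hA, ← Set.iUnion_inter]
    · congr 1
      ext x
      simp
    · exact ((Set.disjoint_singleton.mpr hij).preimage π).mono Set.inter_subset_left
        Set.inter_subset_left
  rw [Measure.map_apply hm hB, hsum _ (hm hB)]
  have hset : ∀ k, π ⁻¹' {k} ∩ (fun x => S x + θ (π x)) ⁻¹' B =
      π ⁻¹' {k} ∩ S ⁻¹' ((fun u => u + θ k) ⁻¹' B) := fun k => by
    ext x
    simp only [Set.mem_inter_iff, Set.mem_preimage, Set.mem_singleton_iff]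
    exact and_congr_right fun h => by rw [h]
  have hone : ∑' k, ν (π ⁻¹' {k}) = 1 := by
    have := hsum Set.univ MeasurableSet.univ
    simpa using this.symm
  simp only [hset]
  rw [tsum_congr fun k => h k _ (measurable_add_const (θ k) hB)]
  simp only [measure_preimage_add_right]
  rw [ENNReal.tsum_mul_right, hone, one_mul]

variable {X : Type*} [MeasurableSpace X] [StandardBorelSpace X]

theorem exists_map_eq_uniform (ν : Measure X) [IsProbabilityMeasure ν] [NullSingletonClass ν] :
    ∃ f : X → ℝ, Measurable f ∧ ν.map f = volume.restrict (Set.Ioc 0 1) := by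
  have he := measurableEmbedding_embeddingReal X
  have := Measure.isProbabilityMeasure_map (μ := ν) he.measurable.aemeasurable
  have : NullSingletonClass (ν.map (embeddingReal X)) := ⟨fun x => by
    rw [he.map_apply]
    exact (Set.subsingleton_singleton.preimage he.injective).measure_zero ν⟩
  refine ⟨cdf (ν.map (embeddingReal X)) ∘ embeddingReal X,
    (continuous_cdf _).measurable.comp he.measurable, ?_⟩
  rw [← Measure.map_map (continuous_cdf _).measurable he.measurable, map_cdf]

theorem exists_map_eq_circle (ν : Measure X) [IsProbabilityMeasure ν] [NullSingletonClass ν] :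
    ∃ f : X → UnitAddCircle, Measurable f ∧ ν.map f = volume := by
  obtain ⟨f, hf, hν⟩ := exists_map_eq_uniform ν
  have hmk := UnitAddCircle.measurePreserving_mk 0
  rw [zero_add] at hmk
  exact ⟨(fun x : ℝ => (x : UnitAddCircle)) ∘ f, hmk.measurable.comp hf, by
    rw [← Measure.map_map hmk.measurable hf, hν, hmk.map_eq]⟩

instance isProbabilityMeasure_circle : IsProbabilityMeasure (volume : Measure UnitAddCircle) :=
  ⟨UnitAddCircle.measure_univ⟩

instance nullSingletonClass_circle : NullSingletonClass (volume : Measure UnitAddCircle) :=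
  ⟨fun x => by
    have h := AddCircle.volume_closedBall (1 : ℝ) (x := x) 0
    rwa [Metric.closedBall_zero, mul_zero, min_eq_right zero_le_one, ENNReal.ofReal_zero] at h⟩

theorem exists_map_circle_eq (ν : Measure X) [IsProbabilityMeasure ν] :
    ∃ g : UnitAddCircle → X, Measurable g ∧ Measure.map g volume = ν := by
  have := ν.nonempty_of_neZero
  obtain ⟨f, hf, hν⟩ := Measure.exists_measurable_map_eq ν
  obtain ⟨u, hu, huv⟩ := exists_map_eq_uniform (volume : Measure UnitAddCircle)
  have hval : Measure.map (Subtype.val : unitInterval → ℝ) volume = volume.restrict (Set.Ioc 0 1) := by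
    rw [restrict_Ioc_eq_restrict_Icc]
    exact map_comap_subtype_coe measurableSet_Icc volume
  have hproj : Measurable (Set.projIcc (0 : ℝ) 1 zero_le_one) := continuous_projIcc.measurable
  refine ⟨f ∘ Set.projIcc 0 1 zero_le_one ∘ u, hf.comp (hproj.comp hu), ?_⟩
  rw [← Measure.map_map hf (hproj.comp hu), ← Measure.map_map hproj hu, huv, ← hval,
    Measure.map_map hproj measurable_subtype_coe, ← hν]
  congr 1
  convert! Measure.map_id
  funext x
  exact Set.projIcc_val zero_le_one x

theorem exists_disjoint_pos (ν : Measure X) [IsProbabilityMeasure ν] [NullSingletonClass ν] :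
    ∃ B : ℕ → Set X, (∀ k, MeasurableSet (B k)) ∧ (∀ k, ν (B k) ≠ 0) ∧
      Pairwise (Function.onFun Disjoint B) := by
  obtain ⟨f, hf, hν⟩ := exists_map_eq_uniform ν
  set r : ℕ → ℝ := fun k => 1 / ((k : ℝ) + 1)
  have hr : Antitone r := fun i j h => one_div_le_one_div_of_le (by positivity) (by gcongr)
  refine ⟨fun k => f ⁻¹' Set.Ioc (r (k + 1)) (r k), fun k => hf measurableSet_Ioc, fun k => ?_, ?_⟩
  · rw [← Measure.map_apply hf measurableSet_Ioc, hν, Measure.restrict_apply measurableSet_Ioc,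
      Set.inter_eq_left.mpr, Real.volume_Ioc]
    · have : r (k + 1) < r k := one_div_lt_one_div_of_lt (by positivity) (by push_cast; linarith)
      simpa using this
    · intro x hx
      refine ⟨lt_trans (by positivity) hx.1, hx.2.trans ((hr (Nat.zero_le k)).trans ?_)⟩
      simp [r]
  · exact fun i j hij => (hr.pairwise_disjoint_on_Ioc_succ hij).preimage f

/-- Conditioning `ν` on a fibre of positive measure again gives an atomless law, which can be mapped
to Haar measure; on null fibres any map will do. -/
theorem exists_uniform_on_fibers (ν : Measure X) [IsProbabilityMeasure ν] [NullSingletonClass ν]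
    {π : X → ℤ} (hπ : Measurable π) : ∃ S : X → UnitAddCircle, Measurable S ∧
      ∀ k B, MeasurableSet B → ν (π ⁻¹' {k} ∩ S ⁻¹' B) = ν (π ⁻¹' {k}) * volume B := by
  have hk : ∀ k, MeasurableSet (π ⁻¹' {k}) := fun k => hπ (measurableSet_singleton k)
  have h : ∀ k, ∃ f : X → UnitAddCircle, Measurable f ∧
      ∀ B, MeasurableSet B → ν (π ⁻¹' {k} ∩ f ⁻¹' B) = ν (π ⁻¹' {k}) * volume B := by
    intro k
    by_cases h0 : ν (π ⁻¹' {k}) = 0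
    · exact ⟨fun _ => 0, measurable_const, fun B _ => by
        rw [h0, zero_mul]
        exact measure_mono_null Set.inter_subset_left h0⟩
    · have := cond_isProbabilityMeasure h0
      have : NullSingletonClass (ν[|π ⁻¹' {k}]) := ⟨fun x => by
        rw [cond_apply (hk k), measure_mono_null Set.inter_subset_right (measure_singleton x),
          mul_zero]⟩
      obtain ⟨f, hf, hν⟩ := exists_map_eq_circle (ν[|π ⁻¹' {k}])
      refine ⟨f, hf, fun B hB => ?_⟩
      rw [← hν, Measure.map_apply hf hB, mul_comm, cond_mul_eq_inter (hk k)]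
  choose f hf hν using h
  refine ⟨fun x => f (π x) x, ?_, fun k B hB => ?_⟩
  · have : Measurable (Function.uncurry f) := measurable_from_prod_countable_right hf
    exact this.comp (hπ.prodMk measurable_id)
  · rw [← hν k B hB]
    congr 1
    ext x
    simp only [Set.mem_inter_iff, Set.mem_preimage, Set.mem_singleton_iff]
    exact and_congr_right fun h => by rw [h]

end Uniform

/-! ### Cutting the sum after `m` charges, with error uniform in the points. -/

section Truncation

variable {X : Type*}

theorem abs_exp_neg_sub_exp_neg_le {u v : ℝ} (hv : 0 ≤ v) (huv : v ≤ u) :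
    |Real.exp (-u) - Real.exp (-v)| ≤ u - v := by
  have h1 : Real.exp (-u) ≤ Real.exp (-v) := Real.exp_le_exp.mpr (neg_le_neg huv)
  have h2 : Real.exp (-u) = Real.exp (-v) * Real.exp (-(u - v)) := by rw [← Real.exp_add]; ring_nf
  have h3 : Real.exp (-v) ≤ 1 := Real.exp_le_one_iff.mpr (by linarith)
  have h4 := Real.add_one_le_exp (-(u - v))
  have h5 := Real.exp_pos (-v)
  rw [abs_sub_comm, abs_of_nonneg (sub_nonneg.mpr h1), h2]
  nlinarith

theorem abs_exp_neg_pairing_sub_le (q : Cone) (y : ℕ → X) {a : X → ℝ} (ha : ∀ x, 0 ≤ a x) {M : ℝ}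
    (hM : ∀ x, a x ≤ M) (m : ℕ) :
    |Real.exp (-pairing (q, y) a) - Real.exp (-∑ i : Fin m, q.1 i * a (y i))| ≤
      M * ∑' i, q.1 (i + m) := by
  have hs : Summable fun i => q.1 i * a (y i) :=
    summable_mul_of_abs_le q.2.2.2 q.2.2.1 fun i => by rw [abs_of_nonneg (ha _)]; exact hM _
  have h0 : ∀ i, 0 ≤ q.1 i * a (y i) := fun i => mul_nonneg (q.2.2.1 i) (ha _)
  have hsum := hs.sum_add_tsum_nat_add m
  rw [Finset.sum_range] at hsum
  have htail : ∑' i, q.1 (i + m) * a (y (i + m)) ≤ M * ∑' i, q.1 (i + m) := by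
    rw [← tsum_mul_left]
    refine Summable.tsum_le_tsum (fun i => ?_) ((summable_nat_add_iff m).mpr hs)
      (((summable_nat_add_iff m).mpr q.2.2.2).mul_left M)
    rw [mul_comm]
    exact mul_le_mul_of_nonneg_right (hM _) (q.2.2.1 _)
  have hle := abs_exp_neg_sub_exp_neg_le (u := pairing (q, y) a)
    (v := ∑ i : Fin m, q.1 i * a (y i)) (Finset.sum_nonneg fun i _ => h0 i)
    (by rw [pairing, ← hsum]; exact le_add_of_nonneg_right (tsum_nonneg fun i => h0 _))
  refine hle.trans ?_
  rw [pairing, ← hsum, add_sub_cancel_left]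
  exact htail

variable [MeasurableSpace X]

theorem exp_neg_pairing_le_one {X : Type*} (p : Cone × (ℕ → X)) {a : X → ℝ} (ha : ∀ x, 0 ≤ a x) :
    Real.exp (-pairing p a) ≤ 1 :=
  Real.exp_le_one_iff.mpr (neg_nonpos.mpr (pairing_nonneg p ha))

theorem measurable_exp_neg_pairing {a : X → ℝ} (ha : Measurable a) :
    Measurable fun p : Cone × (ℕ → X) => Real.exp (-pairing p a) :=
  (measurable_pairing ha).neg.exp

theorem integrable_exp_neg_pairing {Ω : Type*} [MeasurableSpace Ω] (μ : Measure Ω)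
    [IsFiniteMeasure μ] {f : Ω → Cone × (ℕ → X)} (hf : Measurable f) {a : X → ℝ} (ha : Measurable a)
    (h0 : ∀ x, 0 ≤ a x) : Integrable (fun ω => Real.exp (-pairing (f ω) a)) μ := by
  refine Integrable.of_bound ((measurable_exp_neg_pairing ha).comp hf).aestronglyMeasurable 1
    (ae_of_all _ fun ω => ?_)
  rw [Real.norm_eq_abs, Real.abs_exp]
  exact exp_neg_pairing_le_one _ h0

theorem abs_integral_exp_neg_pairing_sub_le {Ω : Type*} [MeasurableSpace Ω] (μ : Measure Ω)
    [IsProbabilityMeasure μ] {Y : Ω → ℕ → X} (hY : Measurable Y) (q : Cone) {a : X → ℝ}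
    (ha : Measurable a) (h0 : ∀ x, 0 ≤ a x) {M : ℝ} (hM : ∀ x, a x ≤ M) (m : ℕ) :
    |∫ ω, Real.exp (-pairing (q, Y ω) a) ∂μ -
      ∫ z, Real.exp (-∑ i : Fin m, q.1 i * a (z i)) ∂(μ.map fun ω (i : Fin m) => Y ω i)| ≤
      M * ∑' i, q.1 (i + m) := by
  have hm : Measurable fun z : Fin m → X => Real.exp (-∑ i : Fin m, q.1 i * a (z i)) := by fun_prop
  have hYm : Measurable fun ω (i : Fin m) => Y ω i :=
    measurable_pi_lambda _ fun i => (measurable_pi_apply _).comp hY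
  rw [integral_map hYm.aemeasurable hm.aestronglyMeasurable, ← integral_sub]
  · have hb : ∀ ω, ‖Real.exp (-pairing (q, Y ω) a) -
        Real.exp (-∑ i : Fin m, q.1 i * a (Y ω i))‖ ≤ M * ∑' i, q.1 (i + m) := fun ω =>
      abs_exp_neg_pairing_sub_le q (Y ω) h0 hM m
    simpa using norm_integral_le_of_norm_le_const (μ := μ) (ae_of_all _ hb)
  · exact integrable_exp_neg_pairing μ (measurable_const.prodMk hY) ha h0
  · refine Integrable.of_bound (hm.comp hYm).aestronglyMeasurable 1 (ae_of_all _ fun ω => ?_)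
    rw [Real.norm_eq_abs, Real.abs_exp, Real.exp_le_one_iff, neg_nonpos]
    exact Finset.sum_nonneg fun i _ => mul_nonneg (q.2.2.1 i) (h0 _)

end Truncation

/-! ### Random measure-preserving maps make the points i.i.d. -/

section Resampling

variable {X : Type*} [MeasurableSpace X] [StandardBorelSpace X]

/-- Points in different cells use different, hence independent, angles, and Haar measure absorbs the
shifts `c i`. -/
theorem map_resample_eq {X : Type*} [MeasurableSpace X] {ν : Measure X} [IsProbabilityMeasure ν] {g : UnitAddCircle → X}
    (hg : Measurable g) (hν : Measure.map g volume = ν) {ι : Type*} (c : ι → UnitAddCircle)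
    {k : ι → ℤ} (hk : Function.Injective k) :
    (Measure.infinitePi fun _ : ℤ => (volume : Measure UnitAddCircle)).map
      (fun θ i => g (c i + θ (k i))) = Measure.infinitePi fun _ : ι => ν := by
  have h1 := Measure.map_infinitePi_infinitePi_of_inj
    (P := fun _ : ℤ => (volume : Measure UnitAddCircle)) hk
  have hm : ∀ i, Measurable fun u : UnitAddCircle => g (c i + u) := fun i =>
    hg.comp (measurable_const_add (c i))
  have h2 := Measure.infinitePi_map_pi (fun _ : ι => (volume : Measure UnitAddCircle)) hm
  have h3 : ∀ i, Measure.map (fun u : UnitAddCircle => g (c i + u)) volume = ν := fun i => by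
    rw [← hν, ← (measurePreserving_add_left volume (c i)).map_eq,
      Measure.map_map hg (measurable_const_add _)]
    rw [(measurePreserving_add_left volume (c i)).map_eq]
    rfl
  simp only [h3] at h2
  rw [← h2, ← h1, Measure.map_map (by fun_prop) (by fun_prop)]
  rfl

theorem tendsto_integral_resample {ν : Measure X} [IsProbabilityMeasure ν] {g : UnitAddCircle → X}
    (hg : Measurable g) (hν : Measure.map g volume = ν) (S : ℕ → X → UnitAddCircle)
    {p : Cone × (ℕ → X)} (hp : Function.Injective p.2) {a : X → ℝ} (ha : Measurable a)
    (h0 : ∀ x, 0 ≤ a x) {M : ℝ} (hM : ∀ x, a x ≤ M) :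
    Tendsto (fun n => ∫ θ, Real.exp (-pairing (p.1,
        fun i => g (S n (p.2 i) + θ (cellIndex X n (p.2 i)))) a)
        ∂(Measure.infinitePi fun _ : ℤ => (volume : Measure UnitAddCircle))) atTop
      (𝓝 (∫ y, Real.exp (-pairing (p.1, y) a) ∂(Measure.infinitePi fun _ : ℕ => ν))) := by
  rw [Metric.tendsto_atTop']
  intro ε hε
  have htail : Tendsto (fun m => M * ∑' i, p.1.1 (i + m)) atTop (𝓝 0) := by
    simpa using (tendsto_sum_nat_add p.1.1).const_mul M
  -- Half of `ε`, because the tail is dropped once from each of the two integrals; the truncated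
  -- integrals coincide exactly for large `n`.
  obtain ⟨m, hm⟩ := (htail.eventually (gt_mem_nhds (half_pos hε))).exists
  have hev : ∀ᶠ n in atTop, Function.Injective fun i : Fin m => cellIndex X n (p.2 i) := by
    have : ∀ i j : Fin m, ∀ᶠ n in atTop, cellIndex X n (p.2 i) = cellIndex X n (p.2 j) → i = j := by
      intro i j
      by_cases hij : i = j
      · exact Eventually.of_forall fun _ _ => hij
      · filter_upwards [eventually_cellIndex_ne (hp.ne (Fin.val_injective.ne hij))] with n hn h
        exact absurd h hn
    filter_upwards [eventually_all.mpr fun i => eventually_all.mpr (this i)] with n hn i j h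
    exact hn i j h
  obtain ⟨N, hN⟩ := eventually_atTop.mp hev
  refine ⟨N, fun n hn => ?_⟩
  have hY : Measurable fun (θ : ℤ → UnitAddCircle) (i : ℕ) =>
      g (S n (p.2 i) + θ (cellIndex X n (p.2 i))) :=
    measurable_pi_lambda _ fun i => hg.comp ((measurable_const_add _).comp (measurable_pi_apply _))
  have e1 := abs_integral_exp_neg_pairing_sub_le
    (Measure.infinitePi fun _ : ℤ => (volume : Measure UnitAddCircle)) hY p.1 ha h0 hM m
  have e2 := abs_integral_exp_neg_pairing_sub_le (Measure.infinitePi fun _ : ℕ => ν)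
    measurable_id p.1 ha h0 hM m
  rw [map_resample_eq hg hν (fun i : Fin m => S n (p.2 i)) (hN n hn.le)] at e1
  simp only [id] at e2
  rw [Measure.map_infinitePi_infinitePi_of_inj (P := fun _ : ℕ => ν) Fin.val_injective] at e2
  rw [Real.dist_eq]
  rw [abs_le] at e1 e2
  rw [abs_lt]
  constructor <;> linarith [e1.1, e1.2, e2.1, e2.2]

/-- Each fixed choice of angles `θ` gives a `ν`-preserving map, so averaging over `θ` leaves the
left side unchanged. For fixed charges and points the average tends to the integral over i.i.d.
points as the partition is refined. -/
theorem laplace_eq_laplace_prod {ν : Measure X} [IsProbabilityMeasure ν] [NullSingletonClass ν]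
    {ρ : Measure (Cone × (ℕ → X))} [IsProbabilityMeasure ρ] (hρ : ∀ᵐ p ∂ρ, IsProper p)
    (hinv : ∀ T : X → X, MeasurePreserving T ν ν → ∀ a : X → ℝ, Measurable a → (∀ x, 0 ≤ a x) →
      (∃ M : ℝ, ∀ x, a x ≤ M) →
      ∫ p, Real.exp (-pairing p (a ∘ T)) ∂ρ = ∫ p, Real.exp (-pairing p a) ∂ρ)
    {a : X → ℝ} (ha : Measurable a) (h0 : ∀ x, 0 ≤ a x) {M : ℝ} (hM : ∀ x, a x ≤ M) :
    ∫ p, Real.exp (-pairing p a) ∂ρ =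
      ∫ p, Real.exp (-pairing p a) ∂((ρ.map Prod.fst).prod (Measure.infinitePi fun _ : ℕ => ν)) := by
  obtain ⟨g, hg, hν⟩ := exists_map_circle_eq ν
  choose S hS hSν using fun n => exists_uniform_on_fibers ν (measurable_cellIndex (X := X) n)
  set Θ := Measure.infinitePi fun _ : ℤ => (volume : Measure UnitAddCircle)
  set T : ℕ → (ℤ → UnitAddCircle) → X → X := fun n θ x => g (S n x + θ (cellIndex X n x))
  have hT : ∀ n θ, MeasurePreserving (T n θ) ν ν := fun n θ =>
    MeasurePreserving.comp ⟨hg, hν⟩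
      (measurePreserving_add_fiberwise (measurable_cellIndex n) (hS n) (hSν n) θ)
  have hjoint : ∀ n, Measurable fun z : (Cone × (ℕ → X)) × (ℤ → UnitAddCircle) =>
      (z.1.1, fun i => T n z.2 (z.1.2 i)) := by
    intro n
    refine (measurable_fst.comp measurable_fst).prodMk (measurable_pi_lambda _ fun i => ?_)
    have hev : Measurable fun z : (ℤ → UnitAddCircle) × ℤ => z.1 z.2 :=
      measurable_from_prod_countable_left fun k => measurable_pi_apply k
    have hx : Measurable fun z : (Cone × (ℕ → X)) × (ℤ → UnitAddCircle) => z.1.2 i :=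
      (measurable_point i).comp measurable_fst
    exact hg.comp (((hS n).comp hx).add
      (hev.comp (measurable_snd.prodMk ((measurable_cellIndex n).comp hx))))
  have hL : ∀ n, ∫ p, Real.exp (-pairing p a) ∂ρ =
      ∫ p, ∫ θ, Real.exp (-pairing (p.1, fun i => T n θ (p.2 i)) a) ∂Θ ∂ρ := by
    intro n
    rw [integral_integral_swap (integrable_exp_neg_pairing (ρ.prod Θ) (hjoint n) ha h0)]
    have : ∀ θ, ∫ p, Real.exp (-pairing (p.1, fun i => T n θ (p.2 i)) a) ∂ρ =
        ∫ p, Real.exp (-pairing p a) ∂ρ := fun θ => hinv (T n θ) (hT n θ) a ha h0 ⟨M, hM⟩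
    simp [this]
  have hlim : Tendsto (fun n => ∫ p, ∫ θ, Real.exp (-pairing (p.1, fun i => T n θ (p.2 i)) a) ∂Θ ∂ρ)
      atTop (𝓝 (∫ p, ∫ y, Real.exp (-pairing (p.1, y) a) ∂(Measure.infinitePi fun _ : ℕ => ν) ∂ρ)) := by
    refine tendsto_integral_of_dominated_convergence (fun _ => 1) (fun n => ?_)
      (integrable_const _) (fun n => ae_of_all _ fun p => ?_) ?_
    · exact (((measurable_exp_neg_pairing ha).comp
        (hjoint n)).stronglyMeasurable.integral_prod_right').aestronglyMeasurable
    · refine (norm_integral_le_of_norm_le_const (C := 1) (ae_of_all _ fun θ => ?_)).trans (by simp)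
      rw [Real.norm_eq_abs, Real.abs_exp]
      exact exp_neg_pairing_le_one _ h0
    · filter_upwards [hρ] with p hp
      exact tendsto_integral_resample hg hν S hp.2 ha h0 hM
  have hmap := Measure.isProbabilityMeasure_map (μ := ρ) measurable_fst.aemeasurable
  rw [integral_prod (fun p => Real.exp (-pairing p a))
    (integrable_exp_neg_pairing _ measurable_id ha h0), integral_map]
  · simp only [← hL] at hlim
    exact tendsto_nhds_unique tendsto_const_nhds hlim
  · exact measurable_fst.aemeasurable
  · exact ((measurable_exp_neg_pairing ha).stronglyMeasurable.integral_prod_right').aestronglyMeasurable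

end Resampling

/-! ### The Laplace exponent of the Lévy measure. -/

section LaplaceExponent

/-- The Laplace exponent `-log ψ_Λ`. -/
def laplaceExponent (Λ : Measure ℝ≥0) (t : ℝ) : ℝ := ∫ s : ℝ≥0, (1 - Real.exp (-(t * s))) ∂Λ

theorem log_psi (Λ : Measure ℝ≥0) (t : ℝ) : Real.log (psi Λ t) = -laplaceExponent Λ t :=
  Real.log_exp _

variable {Λ : Measure ℝ≥0}

theorem one_sub_exp_neg_nonneg {t : ℝ} (ht : 0 ≤ t) (s : ℝ≥0) : 0 ≤ 1 - Real.exp (-(t * s)) :=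
  sub_nonneg.mpr (Real.exp_le_one_iff.mpr (neg_nonpos.mpr (mul_nonneg ht s.2)))

theorem laplaceExponent_nonneg {t : ℝ} (ht : 0 ≤ t) : 0 ≤ laplaceExponent Λ t :=
  integral_nonneg fun s => one_sub_exp_neg_nonneg ht s

theorem laplaceExponent_zero : laplaceExponent Λ 0 = 0 := by simp [laplaceExponent]

theorem IsLevyMeasure.integrable (hΛ : IsLevyMeasure Λ) {t : ℝ} (ht : 0 ≤ t) :
    Integrable (fun s : ℝ≥0 => 1 - Real.exp (-(t * s))) Λ := by
  have hm : Measurable fun s : ℝ≥0 => 1 - Real.exp (-(t * s)) := by fun_prop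
  have h1 : IntegrableOn (fun s : ℝ≥0 => (s : ℝ)) (Set.Ioc 0 1) Λ := by
    refine ⟨NNReal.continuous_coe.aestronglyMeasurable, ?_⟩
    simpa [HasFiniteIntegral] using hΛ.small_jumps
  have h2 : IntegrableOn (fun s : ℝ≥0 => 1 - Real.exp (-(t * s))) (Set.Ioc 0 1) Λ := by
    refine (h1.const_mul t).mono' hm.aestronglyMeasurable (ae_of_all _ fun s => ?_)
    rw [Real.norm_of_nonneg (one_sub_exp_neg_nonneg ht s)]
    linarith [Real.add_one_le_exp (-(t * (s : ℝ)))]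
  have h3 : IntegrableOn (fun s : ℝ≥0 => 1 - Real.exp (-(t * s))) (Set.Ioi 1) Λ := by
    have : IsFiniteMeasure (Λ.restrict (Set.Ioi 1)) := ⟨by simpa using hΛ.tail_finite⟩
    refine Integrable.of_bound hm.aestronglyMeasurable 1 (ae_of_all _ fun s => ?_)
    rw [Real.norm_of_nonneg (one_sub_exp_neg_nonneg ht s)]
    linarith [Real.exp_pos (-(t * (s : ℝ)))]
  have h4 : IntegrableOn (fun s : ℝ≥0 => 1 - Real.exp (-(t * s))) {0} Λ := by
    rw [IntegrableOn, Measure.restrict_eq_zero.mpr hΛ.no_atom_zero]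
    exact integrable_zero_measure
  rw [← integrableOn_univ]
  refine ((h2.union h3).union h4).mono_set fun s _ => ?_
  rcases eq_or_ne s 0 with h | h
  · exact Or.inr h
  · rcases le_or_gt s 1 with h' | h'
    · exact Or.inl (Or.inl ⟨pos_iff_ne_zero.mpr h, h'⟩)
    · exact Or.inl (Or.inr h')

/-- Used for measurability of `log ψ_Λ ∘ a`; integrability is available only for arguments `≥ 0`,
whence the `max`. -/
theorem IsLevyMeasure.monotone_laplaceExponent (hΛ : IsLevyMeasure Λ) :
    Monotone fun t => laplaceExponent Λ (max t 0) := by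
  intro t t' h
  refine integral_mono (hΛ.integrable (le_max_right _ _)) (hΛ.integrable (le_max_right _ _))
    fun s => sub_le_sub_left (Real.exp_le_exp.mpr (neg_le_neg ?_)) _
  exact mul_le_mul_of_nonneg_right (max_le_max_right 0 h) s.2

/-- Infinite total mass makes the exponent unbounded: for `t = n + 1` the integrand is at least
`1/2` on `(1/(n+1), ∞)`, whose mass tends to infinity. -/
theorem IsLevyMeasure.exists_le_laplaceExponent (hΛ : IsLevyMeasure Λ) (K : ℝ) :
    ∃ t, 0 ≤ t ∧ K ≤ laplaceExponent Λ t := by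
  have hU : ⋃ n : ℕ, Set.Ioi (1 / ((n : ℝ≥0) + 1)) = Set.Ioi 0 := by
    ext s
    simp only [Set.mem_iUnion, Set.mem_Ioi]
    exact ⟨fun ⟨n, hn⟩ => lt_of_le_of_lt (by positivity) hn, fun h => exists_nat_one_div_lt h⟩
  have hmono : Monotone fun n : ℕ => Set.Ioi (1 / ((n : ℝ≥0) + 1)) := fun i j h =>
    Set.Ioi_subset_Ioi (one_div_le_one_div_of_le (by positivity) (by gcongr))
  have hlim := tendsto_measure_iUnion_atTop (μ := Λ) hmono
  rw [hU, hΛ.infinite] at hlim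
  obtain ⟨n, hn⟩ := (hlim.eventually (lt_mem_nhds (ENNReal.ofReal_lt_top (r := 2 * K)))).exists
  have ht : (0 : ℝ) ≤ (n : ℝ) + 1 := by positivity
  have hint := hΛ.integrable ht
  refine ⟨n + 1, ht, ?_⟩
  set B := {s : ℝ≥0 | 1 / 2 ≤ 1 - Real.exp (-(((n : ℝ) + 1) * s))}
  have hsub : Set.Ioi (1 / ((n : ℝ≥0) + 1)) ⊆ B := by
    intro s hs
    have h1 : (1 : ℝ) ≤ ((n : ℝ) + 1) * s := by
      have : 1 / ((n : ℝ) + 1) < s := by exact_mod_cast hs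
      rw [div_lt_iff₀ (by positivity)] at this
      linarith
    have h2 : Real.exp (-(((n : ℝ) + 1) * s)) ≤ Real.exp (-1) :=
      Real.exp_le_exp.mpr (neg_le_neg h1)
    have h3 : Real.exp (-1) < 1 / 2 := by
      have := Real.exp_neg_one_lt_d9
      linarith
    rw [Set.mem_ofPred_eq]
    linarith
  have hfin : Λ B < ∞ := hint.measure_ge_lt_top (by norm_num)
  have hmk := mul_meas_ge_le_integral_of_nonneg
    (ae_of_all _ fun s => one_sub_exp_neg_nonneg ht s) hint (1 / 2)
  have h2K : 2 * K ≤ Λ.real B :=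
    (ENNReal.ofReal_le_iff_le_toReal hfin.ne).mp (hn.le.trans (measure_mono hsub))
  change 1 / 2 * Λ.real B ≤ _ at hmk
  change K ≤ ∫ s : ℝ≥0, (1 - Real.exp (-(((n : ℝ) + 1) * s))) ∂Λ
  linarith

end LaplaceExponent

/-! ### Almost every realization is positive with infinitely many atoms. -/

section LevyLaw

variable {X : Type*} [MeasurableSpace X] {ν : Measure X}
  {Λ : Measure ℝ≥0} {P : Measure (D X)}

theorem IsHomogeneousLevyLaw.integral_exp_neg_apply (hP : IsHomogeneousLevyLaw ν Λ P) {A : Set X}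
    (hA : MeasurableSet A) {t : ℝ} (ht : 0 ≤ t) :
    ∫ η : D X, Real.exp (-(t * η.toSignedMeasure A)) ∂P =
      Real.exp (-(ν.real A * laplaceExponent Λ t)) := by
  have h := hP.laplace (A.indicator fun _ => t) (measurable_const.indicator hA)
    (fun x => Set.indicator_nonneg (fun _ _ => ht) x)
    ⟨t, fun x => Set.indicator_le_self' (fun _ _ => ht) x⟩
  simp only [D.integral_indicator_const _ hA, log_psi] at h
  have hind : (fun x => -laplaceExponent Λ (A.indicator (fun _ => t) x)) =
      A.indicator fun _ => -laplaceExponent Λ t := by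
    funext x
    by_cases hx : x ∈ A <;> simp [hx, laplaceExponent_zero]
  rw [h, hind, MeasureTheory.integral_indicator_const _ hA, smul_eq_mul, mul_neg]

/-- The only place where homogeneity enters: the exponent is an integral against `ν`, which `T`
preserves. -/
theorem IsHomogeneousLevyLaw.laplace_comp (hP : IsHomogeneousLevyLaw ν Λ P)
    (hΛ : IsLevyMeasure Λ) {T : X → X} (hT : MeasurePreserving T ν ν) {a : X → ℝ}
    (ha : Measurable a) (h0 : ∀ x, 0 ≤ a x) (hM : ∃ M : ℝ, ∀ x, a x ≤ M) :
    ∫ η : D X, Real.exp (-(η.integral (a ∘ T))) ∂P = ∫ η : D X, Real.exp (-(η.integral a)) ∂P := by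
  obtain ⟨M, hM⟩ := hM
  rw [hP.laplace a ha h0 ⟨M, hM⟩, hP.laplace (a ∘ T) (ha.comp hT.measurable) (fun x => h0 _)
    ⟨M, fun x => hM _⟩]
  have hlog : ∀ x, Real.log (psi Λ (a x)) = -laplaceExponent Λ (max (a x) 0) := fun x => by
    rw [log_psi, max_eq_left (h0 x)]
  have hmeas : Measurable fun x => Real.log (psi Λ (a x)) := by
    simp only [hlog]
    exact (hΛ.monotone_laplaceExponent.measurable.comp ha).neg
  congr 1
  conv_rhs => rw [← hT.map_eq]
  rw [integral_map hT.measurable.aemeasurable hmeas.aestronglyMeasurable]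
  rfl

/-- A Chernoff bound. Letting `t → ∞` with `ε > 0` rules out negative values, and `ε = 0` rules out
the value zero when `ν A ≠ 0`. -/
theorem IsHomogeneousLevyLaw.measureReal_le (hP : IsHomogeneousLevyLaw ν Λ P) {A : Set X}
    (hA : MeasurableSet A) {t : ℝ} (ht : 0 ≤ t) (ε : ℝ) :
    Real.exp (t * ε) * P.real {η | η.toSignedMeasure A ≤ -ε} ≤
      Real.exp (-(ν.real A * laplaceExponent Λ t)) := by
  have := hP.isProbabilityMeasure
  have h := hP.integral_exp_neg_apply hA ht
  have hint : Integrable (fun η : D X => Real.exp (-(t * η.toSignedMeasure A))) P := by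
    -- A non-integrable function has Bochner integral `0`, whereas the Laplace formula gives a
    -- positive value.
    by_contra hn
    rw [integral_undef hn] at h
    exact (Real.exp_pos _).ne h
  rw [← h]
  refine le_trans ?_ (mul_meas_ge_le_integral_of_nonneg
    (ae_of_all _ fun η => (Real.exp_pos _).le) hint (Real.exp (t * ε)))
  refine mul_le_mul_of_nonneg_left (measureReal_mono fun η hη => ?_) (Real.exp_pos _).le
  refine Real.exp_le_exp.mpr ?_
  have := mul_le_mul_of_nonneg_left (show η.toSignedMeasure A ≤ -ε from hη) ht
  linarith

theorem IsHomogeneousLevyLaw.ae_apply_nonneg (hP : IsHomogeneousLevyLaw ν Λ P) {A : Set X}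
    (hA : MeasurableSet A) : ∀ᵐ η ∂P, 0 ≤ η.toSignedMeasure A := by
  have := hP.isProbabilityMeasure
  have h : ∀ n : ℕ, ∀ᵐ η ∂P, -(1 / ((n : ℝ) + 1)) < η.toSignedMeasure A := by
    intro n
    set ε : ℝ := 1 / ((n : ℝ) + 1)
    have hε : 0 < ε := by positivity
    have hb : ∀ k : ℕ, P.real {η | η.toSignedMeasure A ≤ -ε} ≤ Real.exp (-((k : ℝ) * ε)) := by
      intro k
      have h1 := hP.measureReal_le hA k.cast_nonneg ε
      have h2 : Real.exp (-(ν.real A * laplaceExponent Λ k)) ≤ 1 :=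
        Real.exp_le_one_iff.mpr (neg_nonpos.mpr
          (mul_nonneg measureReal_nonneg (laplaceExponent_nonneg k.cast_nonneg)))
      rw [Real.exp_neg, ← one_div, le_div_iff₀ (Real.exp_pos _), mul_comm]
      exact h1.trans h2
    have hlim : Tendsto (fun k : ℕ => Real.exp (-((k : ℝ) * ε))) atTop (𝓝 0) :=
      Real.tendsto_exp_neg_atTop_nhds_zero.comp
        (tendsto_natCast_atTop_atTop.atTop_mul_const hε)
    have h0 : P.real {η | η.toSignedMeasure A ≤ -ε} = 0 :=
      le_antisymm (ge_of_tendsto' hlim hb) measureReal_nonneg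
    rw [measureReal_eq_zero_iff] at h0
    rw [ae_iff]
    simpa only [not_lt] using h0
  filter_upwards [ae_all_iff.mpr h] with η hη
  by_contra! hneg
  obtain ⟨n, hn⟩ := exists_nat_one_div_lt (neg_pos.mpr hneg)
  linarith [hη n]

variable [IsProbabilityMeasure ν]

theorem IsHomogeneousLevyLaw.ae_apply_pos (hP : IsHomogeneousLevyLaw ν Λ P)
    (hΛ : IsLevyMeasure Λ) {A : Set X} (hA : MeasurableSet A) (hνA : ν A ≠ 0) :
    ∀ᵐ η ∂P, 0 < η.toSignedMeasure A := by
  have := hP.isProbabilityMeasure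
  have hpos : 0 < ν.real A := ENNReal.toReal_pos hνA (measure_ne_top ν A)
  have hb : ∀ k : ℕ, P.real {η | η.toSignedMeasure A ≤ -0} ≤ Real.exp (-(k : ℝ)) := by
    intro k
    obtain ⟨t, ht, hk⟩ := hΛ.exists_le_laplaceExponent ((k : ℝ) / ν.real A)
    have h1 := hP.measureReal_le hA ht 0
    rw [mul_zero, Real.exp_zero, one_mul] at h1
    refine h1.trans (Real.exp_le_exp.mpr (neg_le_neg ?_))
    rwa [div_le_iff₀' hpos] at hk
  have hlim : Tendsto (fun k : ℕ => Real.exp (-(k : ℝ))) atTop (𝓝 0) :=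
    Real.tendsto_exp_neg_atTop_nhds_zero.comp tendsto_natCast_atTop_atTop
  have h0 := le_antisymm (ge_of_tendsto' hlim hb) measureReal_nonneg
  rw [measureReal_eq_zero_iff] at h0
  rw [ae_iff]
  simpa only [not_lt, neg_zero] using h0

variable [StandardBorelSpace X] [NullSingletonClass ν]

theorem IsHomogeneousLevyLaw.ae_exists_isCanonical (hP : IsHomogeneousLevyLaw ν Λ P)
    (hΛ : IsLevyMeasure Λ) : ∀ᵐ η ∂P, ∃ p, IsCanonical p ∧ ofAtoms p = η := by
  obtain ⟨B, hB, hνB, hdisj⟩ := exists_disjoint_pos ν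
  have h1 : ∀ᵐ η ∂P, ∀ k : ℕ × ℤ, 0 ≤ η.toSignedMeasure (cell X k.1 k.2) :=
    ae_all_iff.mpr fun k => hP.ae_apply_nonneg (measurableSet_cell _ _)
  have h2 : ∀ᵐ η ∂P, ∀ k, 0 < η.toSignedMeasure (B k) :=
    ae_all_iff.mpr fun k => hP.ae_apply_pos hΛ (hB k) (hνB k)
  filter_upwards [h1, h2] with η h1 h2
  have h0 : ∀ y, 0 ≤ η.toSignedMeasure {y} := fun y =>
    ge_of_tendsto' (η.tendsto_cell y) fun n => h1 (n, cellIndex X n y)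
  refine D.exists_isCanonical h0 ?_
  -- Each of the infinitely many disjoint sets `B k` has positive mass, hence contains an atom.
  have hex : ∀ k, ∃ y ∈ B k, 0 < η.toSignedMeasure {y} := by
    intro k
    by_contra! h
    have hs := η.hasSum_apply (hB k)
    have : (fun y => η.toSignedMeasure {y} * (B k).indicator 1 y) = fun _ => 0 := by
      funext y
      by_cases hy : y ∈ B k
      · simp [le_antisymm (h y hy) (h0 y)]
      · simp [hy]
    rw [this] at hs
    exact (h2 k).ne (hasSum_zero.unique hs)
  choose y hyB hy using hex
  refine (Set.infinite_range_of_injective (f := y) fun i j hij => ?_).mono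
    (Set.range_subset_iff.mpr hy)
  by_contra hne
  exact Set.disjoint_left.mp (hdisj hne) (hyB i) (hij ▸ hyB j)

/-- The law of the charges and the locations of the atoms in the canonical order. -/
theorem IsHomogeneousLevyLaw.exists_law_of_atoms (hP : IsHomogeneousLevyLaw ν Λ P)
    (hΛ : IsLevyMeasure Λ) : ∃ ρ : Measure (Cone × (ℕ → X)), IsProbabilityMeasure ρ ∧
      (∀ᵐ p ∂ρ, IsProper p) ∧ ρ.map ofAtoms = P ∧ ρ.map Prod.fst = conicLaw P ∧
      ∀ a : X → ℝ, Measurable a → (∀ x, 0 ≤ a x) → (∃ M : ℝ, ∀ x, a x ≤ M) →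
        ∫ p, Real.exp (-pairing p a) ∂ρ = ∫ η : D X, Real.exp (-(η.integral a)) ∂P := by
  have := hP.isProbabilityMeasure
  have := ν.nonempty_of_neZero
  obtain ⟨s, hs, hsort⟩ := exists_measurable_sort (X := X)
  have hae := hP.ae_exists_isCanonical hΛ
  refine ⟨P.map s, Measure.isProbabilityMeasure_map hs.aemeasurable, ?_, ?_, ?_, ?_⟩
  · rw [ae_map_iff hs.aemeasurable measurableSet_isProper]
    filter_upwards [hae] with η hη
    obtain ⟨p, hp, rfl⟩ := hη
    rw [hsort p hp]
    exact hp.1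
  · rw [Measure.map_map measurable_ofAtoms hs]
    have : ofAtoms ∘ s =ᵐ[P] id := by
      filter_upwards [hae] with η hη
      obtain ⟨p, hp, rfl⟩ := hη
      simp [hsort p hp]
    rw [Measure.map_congr this, Measure.map_id]
  · rw [Measure.map_map measurable_fst hs, conicLaw]
    refine Measure.map_congr ?_
    filter_upwards [hae] with η hη
    obtain ⟨p, hp, rfl⟩ := hη
    simp [hsort p hp, conicPart_ofAtoms hp.1]
  · rintro a ha h0 ⟨M, hM⟩
    rw [integral_map hs.aemeasurable (measurable_exp_neg_pairing ha).aestronglyMeasurable]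
    refine integral_congr_ae ?_
    filter_upwards [hae] with η hη
    obtain ⟨p, hp, rfl⟩ := hη
    rw [hsort p hp, integral_ofAtoms p ha fun x => by rw [abs_of_nonneg (h0 x)]; exact hM x]

end LevyLaw

/-! ### From exchanges of two tied points to finite permutations. -/

section Ties

variable {X : Type*}

/-- List the points in the order given by a permutation, without changing the charges. -/
def permute (σ : Equiv.Perm ℕ) (p : Cone × (ℕ → X)) : Cone × (ℕ → X) := (p.1, p.2 ∘ σ)

/-- The sequences of charges that are invariant under `σ`. -/
def tieSet (σ : Equiv.Perm ℕ) : Set Cone := {q | q.1 ∘ σ = q.1}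

theorem measurableSet_tieSet (σ : Equiv.Perm ℕ) : MeasurableSet (tieSet σ) := by
  have h : tieSet σ = ⋂ i, {q : Cone | q.1 (σ i) = q.1 i} := by
    ext q
    simp only [tieSet, Set.mem_ofPred_eq, Set.mem_iInter]
    exact funext_iff
  have hq : ∀ i, Measurable fun q : Cone => q.1 i := fun i =>
    (measurable_pi_apply i).comp measurable_subtype_coe
  rw [h]
  exact MeasurableSet.iInter fun i => measurableSet_eq_fun (hq _) (hq _)

variable [MeasurableSpace X]

theorem measurable_permute (σ : Equiv.Perm ℕ) :
    Measurable (permute σ : Cone × (ℕ → X) → Cone × (ℕ → X)) :=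
  measurable_fst.prodMk (measurable_pi_lambda _ fun i => measurable_point (σ i))

theorem measurable_tieSwap (i j : ℕ) :
    Measurable (tieSwap i j : Cone × (ℕ → X) → Cone × (ℕ → X)) := by
  classical
  have : (tieSwap i j : Cone × (ℕ → X) → Cone × (ℕ → X)) =
      fun p => if p.1.1 i = p.1.1 j then permute (Equiv.swap i j) p else p := by
    funext p
    simp only [tieSwap, permute]
  rw [this]
  exact Measurable.ite (measurableSet_eq_fun (measurable_charge i) (measurable_charge j))
    (measurable_permute _) measurable_id

theorem tieSwap_fst {X : Type*} (i j : ℕ) (p : Cone × (ℕ → X)) : (tieSwap i j p).1 = p.1 := by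
  unfold tieSwap
  split_ifs <;> rfl

/-- A permutation of finite support is a product of transpositions of the form `(i, σ i)` and their
inverses. On `tieSet σ` each of these is a `tieSwap`. -/
theorem map_permute_restrict_eq {τ : Measure (Cone × (ℕ → X))}
    (hτ : ∀ i j, τ.map (tieSwap i j) = τ) {σ : Equiv.Perm ℕ}
    (hfin : (MulAction.fixedBy ℕ σ)ᶜ.Finite) :
    (τ.restrict (Prod.fst ⁻¹' tieSet σ)).map (permute σ) = τ.restrict (Prod.fst ⁻¹' tieSet σ) := by
  have hU : MeasurableSet (Prod.fst ⁻¹' tieSet σ : Set (Cone × (ℕ → X))) :=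
    measurable_fst (measurableSet_tieSet σ)
  set μ := τ.restrict (Prod.fst ⁻¹' tieSet σ)
  have hcomp : ∀ ρ ρ' : Equiv.Perm ℕ,
      (permute ρ' ∘ permute ρ : Cone × (ℕ → X) → Cone × (ℕ → X)) = permute (ρ * ρ') :=
    fun ρ ρ' => rfl
  let H : Subgroup (Equiv.Perm ℕ) :=
    { carrier := {ρ | μ.map (permute ρ) = μ}
      one_mem' := Measure.map_id
      mul_mem' := fun {ρ ρ'} h h' => by
        change μ.map (permute (ρ * ρ')) = μ
        rw [← hcomp, ← Measure.map_map (measurable_permute _) (measurable_permute _)]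
        exact (congrArg _ h).trans h'
      inv_mem' := fun {ρ} h => by
        change μ.map (permute ρ⁻¹) = μ
        have h1 : (μ.map (permute ρ)).map (permute ρ⁻¹) = μ := by
          rw [Measure.map_map (measurable_permute _) (measurable_permute _), hcomp, mul_inv_cancel]
          exact Measure.map_id
        rwa [show μ.map (permute ρ) = μ from h] at h1 }
  have hle : Subgroup.closure {ρ : Equiv.Perm ℕ | ∃ i, σ i ≠ i ∧ ρ = Equiv.swap i (σ i)} ≤ H := by
    rw [Subgroup.closure_le]
    rintro _ ⟨i, -, rfl⟩
    change μ.map (permute (Equiv.swap i (σ i))) = μ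
    have h1 : permute (Equiv.swap i (σ i)) =ᵐ[μ] tieSwap i (σ i) := by
      filter_upwards [ae_restrict_mem hU] with p hp
      have : p.1.1 i = p.1.1 (σ i) := (congrFun (show p.1.1 ∘ σ = p.1.1 from hp) i).symm
      simp [tieSwap, permute, this]
    have h2 : (tieSwap i (σ i) : Cone × (ℕ → X) → _) ⁻¹' (Prod.fst ⁻¹' tieSet σ) =
        Prod.fst ⁻¹' tieSet σ := by
      ext p
      simp only [Set.mem_preimage, tieSwap_fst]
    rw [Measure.map_congr h1]
    calc μ.map (tieSwap i (σ i))
        = (τ.map (tieSwap i (σ i))).restrict (Prod.fst ⁻¹' tieSet σ) := by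
          rw [Measure.restrict_map (measurable_tieSwap _ _) hU, h2]
      _ = μ := by rw [hτ]
  refine hle ((mem_closure_isSwap ?_).mpr ⟨hfin, fun i => ?_⟩)
  · rintro _ ⟨i, hi, rfl⟩
    exact ⟨i, σ i, hi.symm, rfl⟩
  · by_cases hi : σ i = i
    · rw [hi]
      exact MulAction.mem_orbit_self i
    · exact ⟨⟨Equiv.swap i (σ i), Subgroup.subset_closure ⟨i, hi, rfl⟩⟩, Equiv.swap_apply_left i (σ i)⟩

end Ties

/-! ### Summing over tie-preserving permutations of an initial block. -/

section Symmetrization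

variable {X : Type*}

instance fintypeSubtypeLT (m : ℕ) : Fintype {i : ℕ // i < m} :=
  Fintype.subtype (Finset.range m) fun _ => Finset.mem_range

/-- A permutation of `{i | i < m}`, extended to `ℕ` by the identity. -/
abbrev extendPerm (m : ℕ) (e : Equiv.Perm {i // i < m}) : Equiv.Perm ℕ :=
  Equiv.Perm.ofSubtype e

theorem finite_compl_fixedBy_extendPerm (m : ℕ) (e : Equiv.Perm {i // i < m}) :
    (MulAction.fixedBy ℕ (extendPerm m e))ᶜ.Finite := by
  refine (Set.finite_Iio m).subset fun i hi => ?_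
  by_contra h
  exact hi (Equiv.Perm.ofSubtype_apply_of_not_mem e h)

/-- The sequences of charges in which the first `m` charges are greater than the others. -/
def cutSet (m : ℕ) : Set Cone := {q | ∀ i < m, q.1 m < q.1 i}

theorem measurableSet_cutSet (m : ℕ) : MeasurableSet (cutSet m) := by
  have h : cutSet m = ⋂ (i) (_ : i < m), {q : Cone | q.1 m < q.1 i} := by
    ext q
    simp [cutSet]
  have hq : ∀ i, Measurable fun q : Cone => q.1 i := fun i =>
    (measurable_pi_apply i).comp measurable_subtype_coe
  rw [h]
  exact MeasurableSet.iInter fun i => MeasurableSet.iInter fun _ => measurableSet_lt (hq _) (hq _)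

/-- Charges are positive and tend to zero, so the first index with charge below `q n` is a cut; it
ends the block of ties containing `n`. -/
theorem exists_mem_cutSet {q : Cone} (hq : ∀ i, 0 < q.1 i) (n : ℕ) : ∃ k, q ∈ cutSet (n + k) := by
  classical
  have hex : ∃ j, q.1 j < q.1 n :=
    (q.2.2.2.tendsto_atTop_zero.eventually (gt_mem_nhds (hq n))).exists
  have hlt : n ≤ Nat.find hex := by
    by_contra! h
    exact (Nat.find_spec hex).not_ge (q.2.1 h.le)
  obtain ⟨k, hk⟩ := Nat.exists_eq_add_of_le hlt
  refine ⟨k, fun i hi => ?_⟩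
  rw [← hk] at hi ⊢
  exact (Nat.find_spec hex).trans_le (not_lt.mp (Nat.find_min hex hi))

/-- The sum of `F` over all lists which arise from `p` by permuting points of equal charge among the
first `m` points. -/
def tieSum (m : ℕ) (F : Cone × (ℕ → X) → ℝ≥0∞) (p : Cone × (ℕ → X)) : ℝ≥0∞ :=
  ∑ e : Equiv.Perm {i // i < m},
    (Prod.fst ⁻¹' tieSet (extendPerm m e)).indicator (fun p => F (permute (extendPerm m e) p)) p

/-- At a cut, `π` maps the first `m` indices to themselves, so it acts on the sum as a translation
of the group of permutations. -/
theorem tieSum_comp_perm {m : ℕ} {F : Cone × (ℕ → X) → ℝ≥0∞}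
    (hF : ∀ q x x', (∀ i < m, x i = x' i) → F (q, x) = F (q, x'))
    {q : Cone} (hq : q ∈ cutSet m) {π : Equiv.Perm ℕ} (hπ : q.1 ∘ π = q.1) (x : ℕ → X) :
    tieSum m F (q, x ∘ π) = tieSum m F (q, x) := by
  have hπ' : ∀ i, q.1 (π i) = q.1 i := congrFun hπ
  have hlt : ∀ i, π i < m ↔ i < m := by
    have : ∀ i, i < m ↔ q.1 m < q.1 i := fun i =>
      ⟨hq i, fun h => lt_of_not_ge fun hi => h.not_ge (q.2.1 hi)⟩
    intro i
    rw [this, this, hπ']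
  set e₀ : Equiv.Perm {i // i < m} := π.subtypePerm hlt
  have h0 : ∀ i < m, extendPerm m e₀ i = π i := fun i hi => by
    rw [extendPerm, Equiv.Perm.ofSubtype_apply_of_mem e₀ hi]
    rfl
  have h0q : q.1 ∘ extendPerm m e₀ = q.1 := by
    funext i
    by_cases hi : i < m
    · rw [Function.comp_apply, h0 i hi, hπ']
    · rw [Function.comp_apply, extendPerm, Equiv.Perm.ofSubtype_apply_of_not_mem e₀ hi]
  unfold tieSum
  refine Fintype.sum_equiv (Equiv.mulLeft e₀) _ _ fun e => ?_
  have hmul : extendPerm m (e₀ * e) = extendPerm m e₀ * extendPerm m e := map_mul _ _ _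
  have hcomp : q.1 ∘ extendPerm m (e₀ * e) = q.1 ∘ extendPerm m e := by
    rw [hmul, Equiv.Perm.coe_mul, ← Function.comp_assoc, h0q]
  have hmem : q ∈ tieSet (extendPerm m e) ↔ q ∈ tieSet (extendPerm m (e₀ * e)) := by
    simp only [tieSet, Set.mem_ofPred_eq, hcomp]
  have hval : F (permute (extendPerm m e) (q, x ∘ π)) =
      F (permute (extendPerm m (e₀ * e)) (q, x)) := by
    refine hF q _ _ fun i hi => ?_
    have : extendPerm m e i < m := by
      rw [extendPerm, Equiv.Perm.ofSubtype_apply_of_mem e hi]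
      exact (e ⟨i, hi⟩).2
    simp only [Function.comp_apply, hmul, Equiv.Perm.mul_apply, h0 _ this]
  have hm : ∀ σ (y : ℕ → X), (q, y) ∈ (Prod.fst ⁻¹' tieSet σ : Set (Cone × (ℕ → X))) ↔
      q ∈ tieSet σ := fun _ _ => Iff.rfl
  rw [Equiv.coe_mulLeft]
  by_cases hmem' : q ∈ tieSet (extendPerm m e)
  · rw [Set.indicator_of_mem ((hm _ _).mpr hmem'), Set.indicator_of_mem ((hm _ _).mpr (hmem.mp hmem')),
      hval]
  · rw [Set.indicator_of_notMem ((hm _ _).not.mpr hmem'),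
      Set.indicator_of_notMem ((hm _ _).not.mpr (hmem.not.mp hmem'))]

/-- The number of permutations of the first `m` charges which do not change the list. -/
def tieCount (m : ℕ) (p : Cone × (ℕ → X)) : ℝ≥0∞ := tieSum m (fun _ => 1) p

theorem tieCount_ne_zero (m : ℕ) (p : Cone × (ℕ → X)) : tieCount m p ≠ 0 := by
  intro h
  have h1 := (Finset.sum_eq_zero_iff.mp h) 1 (Finset.mem_univ _)
  rw [Set.indicator_of_mem] at h1
  · exact one_ne_zero h1
  · simp [tieSet, extendPerm]

theorem tieCount_ne_top (m : ℕ) (p : Cone × (ℕ → X)) : tieCount m p ≠ ∞ := by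
  refine ENNReal.sum_ne_top.mpr fun e _ => ?_
  by_cases hp : p ∈ (Prod.fst ⁻¹' tieSet (extendPerm m e) : Set (Cone × (ℕ → X)))
  · rw [Set.indicator_of_mem hp]; exact ENNReal.one_ne_top
  · rw [Set.indicator_of_notMem hp]; exact ENNReal.zero_ne_top

variable [MeasurableSpace X]

theorem measurable_tieSum (m : ℕ) {F : Cone × (ℕ → X) → ℝ≥0∞} (hF : Measurable F) :
    Measurable (tieSum m F) :=
  Finset.measurable_sum _ fun _ _ => (hF.comp (measurable_permute _)).indicator
    (measurable_fst (measurableSet_tieSet _))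

/-- By invariance on the tie set, each summand has the same integral as the unpermuted `F` there. -/
theorem lintegral_tieSum {τ : Measure (Cone × (ℕ → X))} (hτ : ∀ i j, τ.map (tieSwap i j) = τ)
    (m : ℕ) {F : Cone × (ℕ → X) → ℝ≥0∞} (hF : Measurable F) :
    ∫⁻ p, tieSum m F p ∂τ = ∫⁻ p, tieCount m p * F p ∂τ := by
  have hU : ∀ σ : Equiv.Perm ℕ, MeasurableSet (Prod.fst ⁻¹' tieSet σ : Set (Cone × (ℕ → X))) :=
    fun σ => measurable_fst (measurableSet_tieSet σ)
  have h1 : ∀ p, tieCount m p * F p = ∑ e : Equiv.Perm {i // i < m},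
      (Prod.fst ⁻¹' tieSet (extendPerm m e)).indicator F p := by
    intro p
    rw [tieCount, tieSum, Finset.sum_mul]
    refine Finset.sum_congr rfl fun e _ => ?_
    by_cases hp : p ∈ (Prod.fst ⁻¹' tieSet (extendPerm m e) : Set (Cone × (ℕ → X)))
    · rw [Set.indicator_of_mem hp, Set.indicator_of_mem hp, one_mul]
    · rw [Set.indicator_of_notMem hp, Set.indicator_of_notMem hp, zero_mul]
  simp only [h1]
  unfold tieSum
  have hperm : ∀ e : Equiv.Perm {i // i < m}, Measurable fun p => F (permute (extendPerm m e) p) :=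
    fun e => hF.comp (measurable_permute _)
  rw [lintegral_finsetSum _ fun e _ => (hperm e).indicator (hU _),
    lintegral_finsetSum _ fun e _ => hF.indicator (hU _)]
  refine Finset.sum_congr rfl fun e _ => ?_
  rw [lintegral_indicator (hU _), lintegral_indicator (hU _)]
  conv_rhs => rw [← map_permute_restrict_eq hτ (finite_compl_fixedBy_extendPerm m e)]
  rw [lintegral_map hF (measurable_permute _)]

end Symmetrization

/-! ### The law of the list is determined by `P`. -/

section Uniqueness

variable {X : Type*} [MeasurableSpace X] [StandardBorelSpace X]

theorem IsProper.exists_isCanonical {p : Cone × (ℕ → X)} (hp : IsProper p) :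
    ∃ p', IsCanonical p' ∧ ofAtoms p' = ofAtoms p := by
  have hr := hp.range_eq
  refine D.exists_isCanonical (fun y => ?_) ?_
  · by_cases hy : y ∈ Set.range p.2
    · obtain ⟨i, rfl⟩ := hy
      rw [ofAtoms_singleton hp.2]
      exact (hp.1 i).le
    · rw [ofAtoms_singleton_of_notMem hy]
  · refine (Set.infinite_range_of_injective hp.2).mono (Set.range_subset_iff.mpr fun i => ?_)
    rw [Set.mem_ofPred_eq, ofAtoms_singleton hp.2]
    exact hp.1 i

variable [Nonempty X] {P : Measure (D X)} {τ τ' : Measure (Cone × (ℕ → X))}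

/-- With `F = 1_A / tieCount`, the integral of `tieSum m F` is the measure of `A`. On proper lists
`tieSum m F` does not depend on the order within ties, so it is a function of `ofAtoms p` and its
integral is computed from `P`. -/
theorem IsImageUnderT.measure_inter_cutSet_eq (hτ : IsImageUnderT P τ) (hτ' : IsImageUnderT P τ')
    {m : ℕ} {A : Set (Cone × (ℕ → X))} (hA : MeasurableSet A) (hcut : A ⊆ Prod.fst ⁻¹' cutSet m)
    (hdep : ∀ q x x', (∀ i < m, x i = x' i) → ((q, x) ∈ A ↔ (q, x') ∈ A)) : τ A = τ' A := by
  obtain ⟨s, hs, hsort⟩ := exists_measurable_sort (X := X)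
  have hcount : Measurable (tieCount m : Cone × (ℕ → X) → ℝ≥0∞) := measurable_tieSum m measurable_const
  set F : Cone × (ℕ → X) → ℝ≥0∞ := A.indicator fun p => (tieCount m p)⁻¹
  have hF : Measurable F := hcount.inv.indicator hA
  have hFdep : ∀ q x x', (∀ i < m, x i = x' i) → F (q, x) = F (q, x') := by
    intro q x x' h
    have hc : tieCount m (q, x) = tieCount m (q, x') := rfl
    by_cases hx : (q, x) ∈ A
    · simp only [F, Set.indicator_of_mem hx, Set.indicator_of_mem ((hdep q x x' h).mp hx), hc]
    · simp only [F, Set.indicator_of_notMem hx,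
        Set.indicator_of_notMem fun h' => hx ((hdep q x x' h).mpr h')]
  have hinv : ∀ p, IsProper p → tieSum m F p = tieSum m F (s (ofAtoms p)) := by
    intro p hp
    obtain ⟨p', hp', heq⟩ := hp.exists_isCanonical
    rw [← heq, hsort p' hp']
    obtain ⟨π, h1, h2, h3⟩ := hp.exists_perm hp'.1 heq.symm
    obtain ⟨q, x⟩ := p
    obtain ⟨q', x'⟩ := p'
    simp only at h1 h2 h3
    subst h1 h2
    by_cases hq : q' ∈ cutSet m
    · exact (tieSum_comp_perm hFdep hq h3 x).symm
    · have h0 : ∀ y, tieSum m F (q', y) = 0 := fun y => by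
        refine Finset.sum_eq_zero fun e _ => ?_
        refine (Set.indicator_apply_eq_zero).mpr fun _ => Set.indicator_of_notMem (fun h => hq ?_) _
        exact hcut h
      rw [h0, h0]
  have key : ∀ τ : Measure (Cone × (ℕ → X)), IsImageUnderT P τ →
      τ A = ∫⁻ η, tieSum m F (s η) ∂P := by
    intro τ hτ
    have h1 : ∀ p, tieCount m p * F p = A.indicator 1 p := fun p => by
      by_cases hp : p ∈ A
      · simp only [F, Set.indicator_of_mem hp, Pi.one_apply]
        exact ENNReal.mul_inv_cancel (tieCount_ne_zero m p) (tieCount_ne_top m p)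
      · simp [F, Set.indicator_of_notMem hp]
    rw [← lintegral_indicator_one hA, ← hτ.map_ofAtoms,
      lintegral_map (f := fun η => tieSum m F (s η)) ((measurable_tieSum m hF).comp hs)
        measurable_ofAtoms]
    simp only [← h1]
    rw [← lintegral_tieSum hτ.map_tieSwap m hF]
    refine lintegral_congr_ae ?_
    filter_upwards [hτ.proper] with p hp
    exact hinv p hp
  rw [key τ hτ, key τ' hτ']

/-- Almost every list has a cut at some index `n + k`; splitting `A` by the first such `k` reduces
to the previous case. -/
theorem IsImageUnderT.measure_eq_of_dependsOn (hτ : IsImageUnderT P τ) (hτ' : IsImageUnderT P τ')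
    {n : ℕ} {A : Set (Cone × (ℕ → X))} (hA : MeasurableSet A)
    (hdep : ∀ q x x', (∀ i < n, x i = x' i) → ((q, x) ∈ A ↔ (q, x') ∈ A)) : τ A = τ' A := by
  set V : ℕ → Set Cone := fun k => cutSet (n + k)
  set B : ℕ → Set (Cone × (ℕ → X)) := fun k => A ∩ Prod.fst ⁻¹' disjointed V k
  have hB : ∀ k, MeasurableSet (B k) := fun k =>
    hA.inter (measurable_fst (MeasurableSet.disjointed (fun k => measurableSet_cutSet _) k))
  have key : ∀ τ : Measure (Cone × (ℕ → X)), IsImageUnderT P τ → τ A = ∑' k, τ (B k) := by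
    intro τ hτ
    rw [← measure_iUnion (fun i j hij => ?_) hB]
    · refine measure_congr ?_
      filter_upwards [hτ.proper] with p hp
      refine propext ⟨fun h => ?_, fun h => ?_⟩
      · have : p.1 ∈ ⋃ k, disjointed V k := by
          rw [iUnion_disjointed]
          exact Set.mem_iUnion.mpr (exists_mem_cutSet hp.1 n)
        obtain ⟨k, hk⟩ := Set.mem_iUnion.mp this
        exact Set.mem_iUnion.mpr ⟨k, h, hk⟩
      · obtain ⟨k, hk⟩ := Set.mem_iUnion.mp h
        exact hk.1
    · exact ((disjoint_disjointed V hij).preimage Prod.fst).mono Set.inter_subset_right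
        Set.inter_subset_right
  rw [key τ hτ, key τ' hτ']
  refine tsum_congr fun k => hτ.measure_inter_cutSet_eq hτ' (m := n + k) (hB k)
    (fun p hp => disjointed_subset V k hp.2) fun q x x' h => ?_
  exact and_congr_left fun _ => hdep q x x' fun i hi => h i (by omega)

theorem IsImageUnderT.unique (hτ : IsImageUnderT P τ) (hτ' : IsImageUnderT P τ') : τ = τ' := by
  have := hτ.isProbabilityMeasure
  have := hτ'.isProbabilityMeasure
  refine Measure.ext_prod_iff.mpr fun {B} {t} hB ht => ?_
  have hpre : ∀ τ : Measure (Cone × (ℕ → X)), τ (B ×ˢ t) =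
      (τ.restrict (Prod.fst ⁻¹' B)).map Prod.snd t := fun τ => by
    rw [Measure.map_apply measurable_snd ht, Measure.restrict_apply (measurable_snd ht), Set.prod_eq,
      Set.inter_comm]
  rw [hpre, hpre]
  congr 1
  refine IsProjectiveLimit.unique
    (P := fun I => ((τ'.restrict (Prod.fst ⁻¹' B)).map Prod.snd).map I.restrict) (fun I => ?_)
    fun I => rfl
  ext C hC
  have hI : Measurable (I.restrict (π := fun _ => X)) := Finset.measurable_restrict I
  rw [Measure.map_apply hI hC, Measure.map_apply hI hC, Measure.map_apply measurable_snd (hI hC),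
    Measure.map_apply measurable_snd (hI hC), Measure.restrict_apply (measurable_snd (hI hC)),
    Measure.restrict_apply (measurable_snd (hI hC))]
  refine hτ.measure_eq_of_dependsOn hτ' (n := I.sup id + 1)
    ((measurable_snd (hI hC)).inter (measurable_fst hB)) fun q x x' h => ?_
  have : I.restrict x = I.restrict x' := funext fun i =>
    h i (Nat.lt_succ_of_le (Finset.le_sup (f := id) i.2))
  simp only [Set.mem_inter_iff, Set.mem_preimage, this]

end Uniqueness

/-! ### The product law is an image of `P` under `T`. -/

section Existence

variable {X : Type*} [MeasurableSpace X] [StandardBorelSpace X]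

theorem ae_injective_infinitePi (ν : Measure X) [IsProbabilityMeasure ν] [NullSingletonClass ν] :
    ∀ᵐ y ∂(Measure.infinitePi fun _ : ℕ => ν), Function.Injective y := by
  have h : ∀ i j : ℕ, i ≠ j → ∀ᵐ y ∂(Measure.infinitePi fun _ : ℕ => ν), y i ≠ y j := by
    intro i j hij
    have hmap := Measure.infinitePi_map_eval_prod (P := fun _ : ℕ => ν) hij
    have hdiag : MeasurableSet {z : X × X | z.1 = z.2} := measurableSet_eq_fun measurable_fst measurable_snd
    have h0 : (ν.prod ν) {z : X × X | z.1 = z.2} = 0 := by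
      rw [Measure.measure_prod_null hdiag]
      refine ae_of_all _ fun x => ?_
      have : Prod.mk x ⁻¹' {z : X × X | z.1 = z.2} = {x} := by
        ext y
        exact eq_comm
      simp [this]
    rw [← hmap, Measure.map_apply (by fun_prop) hdiag] at h0
    rw [ae_iff]
    simpa using h0
  have h' : ∀ᵐ y ∂(Measure.infinitePi fun _ : ℕ => ν), ∀ i j : ℕ, i ≠ j → y i ≠ y j :=
    ae_all_iff.mpr fun i => ae_all_iff.mpr fun j => by
      by_cases hij : i = j
      · exact ae_of_all _ fun y hne => absurd hij hne
      · filter_upwards [h i j hij] with y hy _ using hy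
  filter_upwards [h'] with y hy i j he
  by_contra hne
  exact hy i j hne he

/-- For fixed charges the map is either the identity or a swap of two i.i.d. coordinates. -/
theorem map_tieSwap_prod {X : Type*} [MeasurableSpace X] (κ : Measure Cone) [IsProbabilityMeasure κ] (ν : Measure X)
    [IsProbabilityMeasure ν] (i j : ℕ) :
    (κ.prod (Measure.infinitePi fun _ : ℕ => ν)).map (tieSwap i j) =
      κ.prod (Measure.infinitePi fun _ : ℕ => ν) := by
  have hsnd : Measurable fun p : Cone × (ℕ → X) => (tieSwap i j p).2 :=
    measurable_snd.comp (measurable_tieSwap i j)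
  have h := MeasurePreserving.skew_product (MeasurePreserving.id κ)
    (μc := Measure.infinitePi fun _ : ℕ => ν) (μd := Measure.infinitePi fun _ : ℕ => ν)
    (g := fun q y => (tieSwap i j (q, y)).2) hsnd (ae_of_all _ fun q => ?_)
  · convert h.map_eq using 2
    funext p
    exact Prod.ext (tieSwap_fst i j p) rfl
  · by_cases hq : q.1 i = q.1 j
    · simp only [tieSwap, hq, if_true]
      exact Measure.map_infinitePi_infinitePi_of_inj (P := fun _ : ℕ => ν) (Equiv.swap i j).injective
    · simp only [tieSwap, hq, if_false]
      exact Measure.map_id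

theorem IsHomogeneousLevyLaw.isImageUnderT_prod {ν : Measure X} [IsProbabilityMeasure ν]
    [NullSingletonClass ν] {Λ : Measure ℝ≥0} (hΛ : IsLevyMeasure Λ) {P : Measure (D X)}
    (hP : IsHomogeneousLevyLaw ν Λ P) :
    IsProbabilityMeasure (conicLaw P) ∧
      IsImageUnderT P ((conicLaw P).prod (Measure.infinitePi fun _ : ℕ => ν)) := by
  obtain ⟨ρ, hρ, hproper, hmap, hfst, hlaplace⟩ := hP.exists_law_of_atoms hΛ
  have hκ : IsProbabilityMeasure (conicLaw P) := by
    rw [← hfst]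
    exact Measure.isProbabilityMeasure_map measurable_fst.aemeasurable
  refine ⟨hκ, inferInstance, ?_, ?_, map_tieSwap_prod _ ν⟩
  · have hpos : ∀ᵐ q ∂(conicLaw P), ∀ i, 0 < q.1 i := by
      have hm : MeasurableSet {q : Cone | ∀ i, 0 < q.1 i} := by
        rw [Set.ofPred_forall]
        exact MeasurableSet.iInter fun i => measurableSet_lt measurable_const
          ((measurable_pi_apply i).comp measurable_subtype_coe)
      rw [← hfst, ae_map_iff measurable_fst.aemeasurable hm]
      filter_upwards [hproper] with p hp using hp.1
    filter_upwards [Measure.quasiMeasurePreserving_fst.ae hpos,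
      Measure.quasiMeasurePreserving_snd.ae (ae_injective_infinitePi ν)] with p h1 h2
    exact ⟨h1, h2⟩
  · refine Eq.trans ?_ hmap
    refine map_ofAtoms_eq_of_laplace fun a ha h0 hM => ?_
    obtain ⟨M, hM⟩ := hM
    rw [← hfst]
    refine (laplace_eq_laplace_prod hproper (fun T hT b hb hb0 hbM => ?_) ha h0 hM).symm
    rw [hlaplace b hb hb0 hbM, hlaplace (b ∘ T) (hb.comp hT.measurable) (fun x => hb0 _)
      (hbM.imp fun M hM x => hM _), hP.laplace_comp hΛ hT hb hb0 hbM]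

end Existence

end LevyDecomposition

end

theorem theorem1 {X : Type*} [MeasurableSpace X] [StandardBorelSpace X]
    (ν : Measure X) [IsProbabilityMeasure ν] [NullSingletonClass ν]
    (Λ : Measure ℝ≥0) (hΛ : LevyDecomposition.IsLevyMeasure Λ)
    (P : Measure (LevyDecomposition.D X))
    (hP : LevyDecomposition.IsHomogeneousLevyLaw ν Λ P) :
    (∃ τ : Measure (LevyDecomposition.Cone × (ℕ → X)), LevyDecomposition.IsImageUnderT P τ) ∧
    ∀ τ : Measure (LevyDecomposition.Cone × (ℕ → X)), LevyDecomposition.IsImageUnderT P τ →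
      τ = (LevyDecomposition.conicLaw P).prod (Measure.infinitePi fun _ : ℕ => ν) ∧
      (∀ i : ℕ, τ.map (fun p => p.2 i) = ν) ∧
      iIndepFun (fun (i : ℕ) (p : LevyDecomposition.Cone × (ℕ → X)) => p.2 i) τ ∧
      IndepFun (fun p : LevyDecomposition.Cone × (ℕ → X) => p.1)
        (fun p : LevyDecomposition.Cone × (ℕ → X) => p.2) τ := by
  have := ν.nonempty_of_neZero
  obtain ⟨hκ, hprod⟩ := hP.isImageUnderT_prod hΛ
  refine ⟨⟨_, hprod⟩, fun τ hτ => ?_⟩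
  have heq := hτ.unique hprod
  have hsnd : τ.map Prod.snd = Measure.infinitePi fun _ : ℕ => ν := by
    rw [heq]
    exact measurePreserving_snd.map_eq
  have hfst : τ.map Prod.fst = LevyDecomposition.conicLaw P := by
    rw [heq]
    exact measurePreserving_fst.map_eq
  have := hτ.isProbabilityMeasure
  have hi : ∀ i : ℕ, τ.map (fun p => p.2 i) = ν := fun i => by
    rw [← Measure.infinitePi_map_eval (fun _ : ℕ => ν) i, ← hsnd,
      Measure.map_map (measurable_pi_apply i) measurable_snd]
    rfl
  refine ⟨heq, hi, ?_, ?_⟩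
  · rw [iIndepFun_iff_map_fun_eq_infinitePi_map fun i => LevyDecomposition.measurable_point i]
    simp only [hi]
    exact hsnd
  · rw [indepFun_iff_map_prod_eq_prod_map_map measurable_fst.aemeasurable
      measurable_snd.aemeasurable]
    refine (Measure.map_id (μ := τ)).trans ?_
    change τ = (τ.map Prod.fst).prod (τ.map Prod.snd)
    rw [hfst, hsnd, ← heq]
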